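/- Let $d\ge 2$, let $\sigma$ be the spherical Lebesgue measure on the unit sphere $\mathbb S^d\subset\mathbb R^{d+1}$, and put $\omega_k=2\pi^{k/2}/\Gamma(k/2)$ (so that $\sigma(\mathbb S^d)=\omega_{d+1}$) and $\kappa_k=\omega_k/k$. Fix $e\in\mathbb S^d$, let $\mathbb S_e^+=\{u\in\mathbb S^d:\langle u,e\rangle\ge 0\}$ be the closed halfsphere with pole $e$, and let $\mu=\frac{2}{\omega_{d+1}}\,\sigma|_{\mathbb S_e^+}$ be the uniform probability measure on it. For $n\ge d+1$ let $X_1,\dots,X_n$ be independent random points with distribution $\mu$, and let $P_n=\mathbb S^d\cap \operatorname{pos}\{X_1,\dots,X_n\}$ be their spherical convex hull, where $\operatorname{pos}$ denotes the positive hull in $\mathbb R^{d+1}$. Let $f_{d-1}(P_n)$ be the number of facets of $P_n$, that is, of the sets $F\cap\mathbb S^d$ with $F$ a $d$-dimensional face of the cone $\operatorname{pos}P_n$. Then, for every $n\ge d+1$, the random variable $f_{d-1}(P_n)$ is integrable and $$\mathbb E\, f_{d-1}(P_n)=\frac{2\omega_d}{\omega_{d+1}}\binom nd\int_0^\pi\left(1-\frac{\alpha}{\pi}\right)^{n-d}\sin^{d-1}\alpha\,\mathrm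 d\alpha .$$ Further, $$\lim_{n\to\infty}\mathbb E\, f_{d-1}(P_n)=2^{-d}\,d!\,\kappa_d^2 .$$ -/

import Mathlib

open MeasureTheory ProbabilityTheory

noncomputable section

namespace HalfspherePolytope

/-- The Euclidean space `ℝ^(d+1)`. -/
abbrev Space (d : ℕ) : Type := EuclideanSpace ℝ (Fin (d + 1))

/-- The unit sphere `S^d` of `ℝ^(d+1)`. -/
abbrev UnitSphere (d : ℕ) : Type := Metric.sphere (0 : Space d) 1

/-- `ω k = 2 π^(k/2) / Γ(k/2)`, the surface area of the unit sphere of `ℝ^k` (for `k ≥ 1`). -/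
def omega (k : ℕ) : ℝ := 2 * Real.pi ^ ((k : ℝ) / 2) / Real.Gamma ((k : ℝ) / 2)

/-- `κ k = ω k / k`, the volume of the unit ball of `ℝ^k` (for `k ≥ 1`). -/
def kappa (k : ℕ) : ℝ := omega k / k

/-- The spherical Lebesgue measure `σ` on `S^d`. -/
def sphereMeasure (d : ℕ) : Measure (UnitSphere d) := (volume : Measure (Space d)).toSphere

/-- The closed halfsphere with pole `e`. -/
def halfsphere {d : ℕ} (e : UnitSphere d) : Set (UnitSphere d) :=
  {u | 0 ≤ inner ℝ (u : Space d) (e : Space d)}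

/-- The uniform distribution on the closed halfsphere with pole `e`: the restriction of `σ` to the
halfsphere, multiplied by `2 / ω (d+1)`. -/
def uniformHalfsphere {d : ℕ} (e : UnitSphere d) : Measure (UnitSphere d) :=
  ENNReal.ofReal (2 / omega (d + 1)) • (sphereMeasure d).restrict (halfsphere e)

/-- The positive hull in `ℝ^(d+1)` of a subset of the sphere. -/
def pos {d : ℕ} (A : Set (UnitSphere d)) : PointedCone ℝ (Space d) :=
  PointedCone.hull ℝ ((fun u : UnitSphere d => (u : Space d)) '' A)

/-- The spherical convex hull: the intersection of the sphere with the positive hull. -/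
def convS {d : ℕ} (A : Set (UnitSphere d)) : Set (UnitSphere d) :=
  {u | (u : Space d) ∈ pos A}

/-- The `k`-dimensional faces of a spherical polytope `P`: the intersections with the sphere of
those faces of the cone spanned by `P` that have linear dimension `k + 1`. -/
def faces {d : ℕ} (k : ℕ) (P : Set (UnitSphere d)) : Set (Set (UnitSphere d)) :=
  {G | ∃ F : PointedCone ℝ (Space d), F.IsFaceOf (pos P) ∧
    Module.finrank ℝ (Submodule.span ℝ (F : Set (Space d))) = k + 1 ∧
    G = {u : UnitSphere d | (u : Space d) ∈ F}}

/-- The number of `k`-dimensional faces of a spherical polytope. -/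
def faceNumber {d : ℕ} (k : ℕ) (P : Set (UnitSphere d)) : ℕ := (faces k P).ncard

/-- The random variables `X i` are independent uniform random points of the closed halfsphere with
pole `e`, on a space with measure `Q`. -/
structure IsUniformSample {d : ℕ} (e : UnitSphere d) {Ω : Type*} [MeasurableSpace Ω]
    (Q : Measure Ω) {n : ℕ} (X : Fin n → Ω → UnitSphere d) : Prop where
  indep : iIndepFun X Q
  law : ∀ i, HasLaw (X i) (uniformHalfsphere e) Q

/-- The random spherical polytope `P_n`, the spherical convex hull of the random points. -/
def randomPolytope {d n : ℕ} {Ω : Type*} (X : Fin n → Ω → UnitSphere d) (ω : Ω) :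
    Set (UnitSphere d) :=
  convS (Set.range fun i => X i ω)

end HalfspherePolytope

end

/-! Almost surely the points are in general position: any `d + 1` of them are linearly independent.
Then each facet of the cone is spanned by exactly `d` of the points, and a `d`-subset spans a facet
iff all remaining points lie strictly on one side of its hyperplane (`faceNumber_convS_range`,
`supporting_iff_oneSided`). So the facet number is almost surely a sum of `n.choose d` indicators of
equal probability, which gives integrability as well as the expectation.

Fix `d` of the points, with normal `w` at angle `α` to the pole. The halfspace `⟨w, u⟩ > 0` cuts the
halfsphere in a lune of probability `1 - α / π` (`uniformHalfsphere_inner_pos`), so the other `m = n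
- d` points are on one side with probability `(1 - α/π)^m + (α/π)^m`. This is invariant under `α ↦ π
- α`, hence independent of the sign of `w`.

The law of `α`, tested on such symmetric functions, needs no integral-geometric transformation.
Replacing a point by its antipode only flips `w`, so the points may be taken uniform on the whole
sphere (`map_foldTo`). By isometry invariance the pole may then be averaged over the sphere, and
after Tonelli the normal is fixed and the pole is uniform: the density is `ω_d / ω_{d+1} * sin^{d-1}
α` (`lintegral_angle_normalVec`).

For the limit, the substitution `s = m α` and dominated convergence reduce the integral to a Gamma
integral (`tendsto_pow_mul_integral_sin`), and Legendre's duplication formula gives the stated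
constant (`omega_ratio`). -/

noncomputable section

namespace HalfspherePolytope

/-! ### Polar coordinates and integration over the sphere. -/

section Polar

variable {E : Type*} [NormedAddCommGroup E] [NormedSpace ℝ E] [MeasurableSpace E] [BorelSpace E]
  [FiniteDimensional ℝ E] [Nontrivial E] (μ : Measure E) [μ.IsAddHaarMeasure]

theorem lintegral_eq_lintegral_toSphere {F : E → ENNReal} (hF : Measurable F) :
    ∫⁻ x, F x ∂μ = ∫⁻ u : Metric.sphere (0 : E) 1, (∫⁻ r in Set.Ioi (0 : ℝ),
      ENNReal.ofReal (r ^ (Module.finrank ℝ E - 1)) * F (r • (u : E))) ∂μ.toSphere := by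
  have hG : Measurable fun p : Metric.sphere (0 : E) 1 × Set.Ioi (0 : ℝ) =>
      F ((p.2 : ℝ) • (p.1 : E)) := by fun_prop
  calc
    ∫⁻ x, F x ∂μ = ∫⁻ x : ({(0)}ᶜ : Set E), F x ∂(μ.comap (↑)) := by
      rw [lintegral_subtype_comap (measurableSet_singleton _).compl F,
        restrict_compl_singleton]
    _ = ∫⁻ p, F ((p.2 : ℝ) • (p.1 : E))
          ∂μ.toSphere.prod (.volumeIoiPow (Module.finrank ℝ E - 1)) := by
      rw [← μ.measurePreserving_homeomorphUnitSphereProd.lintegral_comp hG]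
      refine lintegral_congr fun x => ?_
      have := homeomorphUnitSphereProd_symm_apply_coe E (homeomorphUnitSphereProd E x)
      rw [Homeomorph.symm_apply_apply] at this
      rw [← this]
    _ = _ := by
      rw [lintegral_prod _ hG.aemeasurable]
      refine lintegral_congr fun u => ?_
      have hGu : Measurable fun r : Set.Ioi (0 : ℝ) => F ((r : ℝ) • (u : E)) := by fun_prop
      rw [Measure.volumeIoiPow, lintegral_withDensity_eq_lintegral_mul _ (by fun_prop) hGu]
      exact lintegral_subtype_comap measurableSet_Ioi
        fun r : ℝ => ENNReal.ofReal (r ^ (Module.finrank ℝ E - 1)) * F (r • (u : E))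

theorem lintegral_fun_norm {G : ℝ → ENNReal} (hG : Measurable G) :
    ∫⁻ x, G ‖x‖ ∂μ = μ.toSphere Set.univ * ∫⁻ r in Set.Ioi (0 : ℝ),
      ENNReal.ofReal (r ^ (Module.finrank ℝ E - 1)) * G r := by
  rw [lintegral_eq_lintegral_toSphere μ (F := fun x => G ‖x‖) (by fun_prop), mul_comm]
  rw [← lintegral_const]
  refine lintegral_congr fun u => setLIntegral_congr_fun measurableSet_Ioi fun r hr => ?_
  simp [norm_smul, abs_of_pos (Set.mem_Ioi.1 hr)]

theorem lintegral_Ioo_pow (n : ℕ) :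
    ∫⁻ r in Set.Ioo (0 : ℝ) 1, ENNReal.ofReal (r ^ n) = ((n + 1 : ℕ) : ENNReal)⁻¹ := by
  have h := Measure.volumeIoiPow_apply_Iio n ⟨1, Set.mem_Ioi.2 one_pos⟩
  rw [Measure.volumeIoiPow, withDensity_apply _ measurableSet_Iio,
    setLIntegral_subtype measurableSet_Ioi _ fun a : ℝ ↦ .ofReal (a ^ n),
    Set.image_subtype_val_Ioi_Iio] at h
  rw [h, ← ENNReal.ofReal_natCast, ← ENNReal.ofReal_inv_of_pos (by positivity)]
  simp

/-- A function constant along rays has radial integral `1 / dim` times its spherical value over the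
unit ball. This moves spherical integrals to Lebesgue integrals, where orthogonal coordinates are
available. -/
theorem lintegral_toSphere {g : E → ENNReal} (hg : Measurable g)
    (hom : ∀ (r : ℝ) (x : E), 0 < r → g (r • x) = g x) :
    ∫⁻ u, g u ∂μ.toSphere = Module.finrank ℝ E * ∫⁻ x in Metric.ball (0 : E) 1, g x ∂μ := by
  rw [← lintegral_indicator measurableSet_ball,
    lintegral_eq_lintegral_toSphere μ (hg.indicator measurableSet_ball)]
  have key : ∀ u : Metric.sphere (0 : E) 1, ∫⁻ r in Set.Ioi (0 : ℝ),
      ENNReal.ofReal (r ^ (Module.finrank ℝ E - 1)) *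
        (Metric.ball (0 : E) 1).indicator g (r • (u : E)) =
      (Module.finrank ℝ E : ENNReal)⁻¹ * g u := by
    intro u
    have h1 : ∀ r ∈ Set.Ioi (0 : ℝ), ENNReal.ofReal (r ^ (Module.finrank ℝ E - 1)) *
        (Metric.ball (0 : E) 1).indicator g (r • (u : E)) =
        (Set.Iio (1 : ℝ)).indicator
          (fun r => ENNReal.ofReal (r ^ (Module.finrank ℝ E - 1)) * g u) r := by
      intro r hr
      have hr' := Set.mem_Ioi.1 hr
      by_cases h : r < 1 <;> simp [h, norm_smul, abs_of_pos hr', hom, hr']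
    rw [setLIntegral_congr_fun measurableSet_Ioi h1, lintegral_indicator measurableSet_Iio,
      Measure.restrict_restrict measurableSet_Iio, Set.Iio_inter_Ioi,
      lintegral_mul_const _ (by fun_prop), lintegral_Ioo_pow,
      Nat.sub_add_cancel (Module.finrank_pos (R := ℝ))]
  simp_rw [key]
  rw [lintegral_const_mul _ (by fun_prop), ← mul_assoc, ENNReal.mul_inv_cancel, one_mul]
  · simpa using (Module.finrank_pos (R := ℝ) (M := E)).ne'
  · simp

end Polar

/-! ### Slicing Euclidean space along one or two orthonormal directions. -/

theorem measurePreserving_cons (k : ℕ) :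
    MeasurePreserving (fun p : ℝ × EuclideanSpace ℝ (Fin k) =>
      (WithLp.toLp 2 (Fin.cons p.1 p.2 : Fin (k + 1) → ℝ) : EuclideanSpace ℝ (Fin (k + 1))))
      volume volume := by
  have h1 := (MeasurePreserving.id (volume : Measure ℝ)).prod (PiLp.volume_preserving_ofLp (Fin k))
  have h2 := (volume_preserving_piFinSuccAbove (fun _ : Fin (k + 1) => ℝ) 0).symm
  have h3 := (PiLp.volume_preserving_toLp (Fin (k + 1))).comp (h2.comp h1)
  have heq : (fun p : ℝ × EuclideanSpace ℝ (Fin k) =>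
      (WithLp.toLp 2 (Fin.cons p.1 p.2 : Fin (k + 1) → ℝ) : EuclideanSpace ℝ (Fin (k + 1)))) =
      WithLp.toLp 2 ∘ (MeasurableEquiv.piFinSuccAbove (fun _ : Fin (k + 1) => ℝ) 0).symm ∘
        Prod.map id WithLp.ofLp := by
    funext p
    ext i
    simp [MeasurableEquiv.piFinSuccAbove, Fin.insertNthEquiv, Fin.insertNth_zero']
  rw [heq]
  exact h3

theorem lintegral_one_coord {k : ℕ} {e : EuclideanSpace ℝ (Fin (k + 1))} (he : ‖e‖ = 1)
    {F : ℝ → ℝ → ENNReal} (hF : Measurable (Function.uncurry F)) :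
    ∫⁻ x : EuclideanSpace ℝ (Fin (k + 1)), F (inner ℝ e x) (‖x‖ ^ 2) =
      ∫⁻ t : ℝ, ∫⁻ z : EuclideanSpace ℝ (Fin k), F t (t ^ 2 + ‖z‖ ^ 2) := by
  obtain ⟨b, hb⟩ := Orthonormal.exists_orthonormalBasis_extension_of_card_eq
    (𝕜 := ℝ) (E := EuclideanSpace ℝ (Fin (k + 1))) (ι := Fin (k + 1)) (by simp) (v := fun _ => e)
    (s := {0}) (by
      constructor
      · intro i; simpa using he
      · intro i j hij; exact absurd (Subsingleton.elim i j) hij)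
  have hb0 : b 0 = e := hb 0 rfl
  have hmp := (b.measurePreserving_repr_symm).comp (measurePreserving_cons k)
  have hm : Measurable fun x : EuclideanSpace ℝ (Fin (k + 1)) => F (inner ℝ e x) (‖x‖ ^ 2) :=
    hF.comp (f := fun x => (inner ℝ e x, ‖x‖ ^ 2)) (by fun_prop)
  rw [← hmp.lintegral_comp hm]
  rw [Measure.volume_eq_prod, lintegral_prod _ (by
    exact (hm.comp hmp.measurable).aemeasurable)]
  refine lintegral_congr fun t => lintegral_congr fun z => ?_
  simp only [Function.comp]
  congr 1
  · rw [← hb0, ← b.repr.inner_map_map]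
    simp [OrthonormalBasis.repr_self, EuclideanSpace.inner_single_left]
  · rw [LinearIsometryEquiv.norm_map, EuclideanSpace.norm_sq_eq, EuclideanSpace.norm_sq_eq,
      Fin.sum_univ_succ]
    simp

theorem lintegral_two_coord {k : ℕ} {a b : EuclideanSpace ℝ (Fin (k + 2))} (ha : ‖a‖ = 1)
    (hb : ‖b‖ = 1) (hab : inner ℝ a b = 0)
    {F : ℝ → ℝ → ℝ → ENNReal} (hF : Measurable fun p : ℝ × ℝ × ℝ => F p.1 p.2.1 p.2.2) :
    ∫⁻ x : EuclideanSpace ℝ (Fin (k + 2)), F (inner ℝ a x) (inner ℝ b x) (‖x‖ ^ 2) =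
      ∫⁻ p : ℝ × ℝ, ∫⁻ z : EuclideanSpace ℝ (Fin k), F p.1 p.2 (p.1 ^ 2 + p.2 ^ 2 + ‖z‖ ^ 2) := by
  obtain ⟨B, hB⟩ := Orthonormal.exists_orthonormalBasis_extension_of_card_eq
    (𝕜 := ℝ) (E := EuclideanSpace ℝ (Fin (k + 2))) (ι := Fin (k + 2)) (by simp)
    (v := Fin.cons a (Fin.cons b 0))
    (s := {0, 1}) (by
      constructor
      · rintro ⟨i, rfl | rfl⟩
        · simpa using ha
        · simpa using hb
      · rintro ⟨i, rfl | rfl⟩ ⟨j, rfl | rfl⟩ hij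
        · exact absurd rfl hij
        · simpa using hab
        · simpa [real_inner_comm] using hab
        · exact absurd rfl hij)
  have hB0 : B 0 = a := hB 0 (by simp)
  have hB1 : B 1 = b := by simpa using hB 1 (by simp)
  have hmp := (B.measurePreserving_repr_symm).comp ((measurePreserving_cons (k + 1)).comp
    ((MeasurePreserving.id (volume : Measure ℝ)).prod (measurePreserving_cons k)))
  have hm : Measurable fun x : EuclideanSpace ℝ (Fin (k + 2)) =>
      F (inner ℝ a x) (inner ℝ b x) (‖x‖ ^ 2) :=
    hF.comp (f := fun x => (inner ℝ a x, inner ℝ b x, ‖x‖ ^ 2)) (by fun_prop)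
  have hmp2 := hmp.comp (volume_preserving_prodAssoc (α₁ := ℝ) (β₁ := ℝ)
    (γ₁ := EuclideanSpace ℝ (Fin k)))
  rw [← hmp2.lintegral_comp hm]
  rw [Measure.volume_eq_prod (ℝ × ℝ), lintegral_prod _ (by
    exact (hm.comp hmp2.measurable).aemeasurable)]
  refine lintegral_congr fun t => lintegral_congr fun z => ?_
  have hassoc : MeasurableEquiv.prodAssoc (t, z) = (t.1, t.2, z) := rfl
  simp only [Function.comp, hassoc, Prod.map, id]
  congr 1
  · rw [← hB0, ← B.repr.inner_map_map]
    simp [OrthonormalBasis.repr_self, EuclideanSpace.inner_single_left]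
  · rw [← hB1, ← B.repr.inner_map_map]
    simp only [OrthonormalBasis.repr_self, EuclideanSpace.inner_single_left,
      LinearIsometryEquiv.apply_symm_apply, map_one, one_mul]
    rfl
  · rw [LinearIsometryEquiv.norm_map, EuclideanSpace.norm_sq_eq, EuclideanSpace.norm_sq_eq,
      Fin.sum_univ_succ, Fin.sum_univ_succ]
    simp [add_assoc]

/-! ### The angle to a fixed vector and the measure of lunes. -/

theorem omega_pos {k : ℕ} (hk : 0 < k) : 0 < omega k := by
  have : 0 < Real.Gamma ((k : ℝ) / 2) := Real.Gamma_pos_of_pos (by positivity)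
  unfold omega
  positivity

theorem toSphere_univ_eq_omega {k : ℕ} (hk : 0 < k) :
    (volume : Measure (EuclideanSpace ℝ (Fin k))).toSphere Set.univ =
      ENNReal.ofReal (omega k) := by
  have : Nonempty (Fin k) := ⟨⟨0, hk⟩⟩
  have hk' : (0 : ℝ) < k := by exact_mod_cast hk
  rw [Measure.toSphere_apply_univ, EuclideanSpace.volume_ball]
  simp only [finrank_euclideanSpace, Fintype.card_fin, ENNReal.ofReal_one, one_pow, one_mul]
  rw [← ENNReal.ofReal_natCast, ← ENNReal.ofReal_mul (by positivity)]
  congr 1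
  have hΓ : Real.Gamma ((k : ℝ) / 2) ≠ 0 := (Real.Gamma_pos_of_pos (by positivity)).ne'
  rw [Real.Gamma_add_one (by positivity), omega, Real.sqrt_eq_rpow, ← Real.rpow_natCast,
    ← Real.rpow_mul Real.pi_pos.le]
  field_simp

theorem lintegral_polar_rect {n : ℕ} {g : ℝ → ENNReal} (hg : Measurable g) :
    ∫⁻ p in Set.Ioo (0 : ℝ) 1 ×ˢ Set.Ioo (0 : ℝ) Real.pi, ENNReal.ofReal (p.1 ^ n) * g p.2 =
      ((n + 1 : ℕ) : ENNReal)⁻¹ * ∫⁻ α in Set.Ioo (0 : ℝ) Real.pi, g α := by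
  rw [Measure.volume_eq_prod, ← Measure.prod_restrict,
    lintegral_prod_mul (f := fun x : ℝ => ENNReal.ofReal (x ^ n)) (by fun_prop) hg.aemeasurable,
    lintegral_Ioo_pow]

/-- Over the unit ball, use the coordinate `t` along `e` and the distance `r` from the axis, with
weight `r^(d-1)`. Planar polar coordinates in `(t, r)` turn the weight into `ρ^d sin^(d-1) θ`, where
`θ` is the angle to `e`; the `ρ`-integral cancels the dimension factor `d + 1`. -/
theorem lintegral_angle {d : ℕ} (hd : 1 ≤ d) {e : Space d} (he : ‖e‖ = 1) {g : ℝ → ENNReal}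
    (hg : Measurable g) :
    ∫⁻ u : UnitSphere d, g (InnerProductGeometry.angle e (u : Space d)) ∂(sphereMeasure d) =
      ENNReal.ofReal (omega d) * ∫⁻ α in Set.Ioo (0 : ℝ) Real.pi,
        ENNReal.ofReal (Real.sin α ^ (d - 1)) * g α := by
  have : Nonempty (Fin d) := ⟨⟨0, hd⟩⟩
  let F : ℝ → ℝ → ENNReal := fun t s =>
    (Set.Iio (1 : ℝ)).indicator (fun s => g (Real.arccos (t / Real.sqrt s))) s
  have hF : Measurable (Function.uncurry F) := by
    have h1 : Measurable fun p : ℝ × ℝ => g (Real.arccos (p.1 / Real.sqrt p.2)) :=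
      hg.comp (Real.continuous_arccos.measurable.comp (by fun_prop))
    exact h1.indicator (measurableSet_Iio.preimage measurable_snd)
  have hang : Measurable fun x : Space d => g (InnerProductGeometry.angle e x) := by
    unfold InnerProductGeometry.angle
    exact hg.comp (Real.continuous_arccos.measurable.comp (by fun_prop))
  unfold sphereMeasure
  rw [lintegral_toSphere volume hang
    (fun r x hr => by rw [InnerProductGeometry.angle_smul_right_of_pos _ _ hr]),
    ← lintegral_indicator measurableSet_ball]
  have h1 : ∀ x : Space d, (Metric.ball (0 : Space d) 1).indicator
      (fun x => g (InnerProductGeometry.angle e x)) x = F (inner ℝ e x) (‖x‖ ^ 2) := by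
    intro x
    simp only [F, Set.indicator, Metric.mem_ball, dist_zero_right, Set.mem_Iio,
      InnerProductGeometry.angle, he, one_mul, Real.sqrt_sq (norm_nonneg x)]
    simp [sq_lt_one_iff_abs_lt_one]
  simp_rw [h1]
  rw [lintegral_one_coord he hF]
  have h2 : ∀ t : ℝ, ∫⁻ z : EuclideanSpace ℝ (Fin d), F t (t ^ 2 + ‖z‖ ^ 2) =
      ENNReal.ofReal (omega d) * ∫⁻ r : ℝ, (Set.Ioi (0 : ℝ)).indicator
        (fun r => ENNReal.ofReal (r ^ (d - 1)) * F t (t ^ 2 + r ^ 2)) r := by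
    intro t
    have hm : Measurable fun r : ℝ => F t (t ^ 2 + r ^ 2) :=
      hF.comp (f := fun r : ℝ => (t, t ^ 2 + r ^ 2)) (by fun_prop)
    rw [lintegral_fun_norm volume hm, toSphere_univ_eq_omega hd, finrank_euclideanSpace,
      Fintype.card_fin, lintegral_indicator measurableSet_Ioi]
  simp_rw [h2]
  have hH : Measurable fun p : ℝ × ℝ => (Set.Ioi (0 : ℝ)).indicator
        (fun r => ENNReal.ofReal (r ^ (d - 1)) * F p.1 (p.1 ^ 2 + r ^ 2)) p.2 := by
    have h1 : Measurable fun p : ℝ × ℝ =>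
        ENNReal.ofReal (p.2 ^ (d - 1)) * F p.1 (p.1 ^ 2 + p.2 ^ 2) :=
      Measurable.mul (by fun_prop)
        (hF.comp (f := fun p : ℝ × ℝ => (p.1, p.1 ^ 2 + p.2 ^ 2)) (by fun_prop))
    exact h1.indicator (measurableSet_Ioi.preimage measurable_snd)
  rw [lintegral_const_mul _ hH.lintegral_prod_right', mul_left_comm]
  congr 1
  rw [← lintegral_prod (f := fun p : ℝ × ℝ => (Set.Ioi (0 : ℝ)).indicator
        (fun r => ENNReal.ofReal (r ^ (d - 1)) * F p.1 (p.1 ^ 2 + r ^ 2)) p.2) hH.aemeasurable,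
    ← Measure.volume_eq_prod, ← lintegral_comp_polarCoord_symm]
  have h3 : ∀ p ∈ polarCoord.target, ENNReal.ofReal p.1 • ((Set.Ioi (0 : ℝ)).indicator
        (fun r => ENNReal.ofReal (r ^ (d - 1)) *
          F (polarCoord.symm p).1 ((polarCoord.symm p).1 ^ 2 + r ^ 2)) (polarCoord.symm p).2) =
      (Set.Ioo (0 : ℝ) 1 ×ˢ Set.Ioo (0 : ℝ) Real.pi).indicator (fun p =>
        ENNReal.ofReal (p.1 ^ d) * (ENNReal.ofReal (Real.sin p.2 ^ (d - 1)) * g p.2)) p := by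
    rintro ⟨ρ, θ⟩ hp
    rw [polarCoord_target] at hp
    obtain ⟨hρ, hθ⟩ := hp
    simp only [Set.mem_Ioi, Set.mem_Ioo] at hρ hθ
    simp only [polarCoord_symm_apply]
    by_cases hθ0 : 0 < θ
    · have hs : 0 < Real.sin θ := Real.sin_pos_of_pos_of_lt_pi hθ0 hθ.2
      have hsq : (ρ * Real.cos θ) ^ 2 + (ρ * Real.sin θ) ^ 2 = ρ ^ 2 := by
        nlinarith [Real.sin_sq_add_cos_sq θ]
      rw [Set.indicator_of_mem (by simp [hρ, hs]), hsq]
      by_cases hρ1 : ρ < 1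
      · rw [Set.indicator_of_mem (by simp [hρ, hρ1, hθ0, hθ.2])]
        simp only [F]
        rw [Set.indicator_of_mem (by simp [sq_lt_one_iff_abs_lt_one, abs_of_pos hρ, hρ1]),
          Real.sqrt_sq hρ.le, mul_div_cancel_left₀ _ hρ.ne', Real.arccos_cos hθ0.le hθ.2.le,
          smul_eq_mul, ← mul_assoc, ← mul_assoc, ← ENNReal.ofReal_mul hρ.le,
          ← ENNReal.ofReal_mul (by positivity)]
        congr 2
        obtain ⟨k, rfl⟩ : ∃ k, d = k + 1 := ⟨d - 1, by omega⟩
        simp only [Nat.add_sub_cancel]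
        ring
      · rw [Set.indicator_of_notMem (by simp [hρ1])]
        simp only [F]
        rw [Set.indicator_of_notMem (by simp [sq_lt_one_iff_abs_lt_one, abs_of_pos hρ, hρ1])]
        simp
    -- These angles correspond to `r ≤ 0`, which the indicator of `r > 0` excludes.
    · have hs : Real.sin θ ≤ 0 :=
        Real.sin_nonpos_of_nonpos_of_neg_pi_le (not_lt.1 hθ0) hθ.1.le
      rw [Set.indicator_of_notMem (by simpa using mul_nonpos_of_nonneg_of_nonpos hρ.le hs),
        Set.indicator_of_notMem (by simp [hθ0])]
      simp
  rw [setLIntegral_congr_fun polarCoord.open_target.measurableSet h3,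
    lintegral_indicator (measurableSet_Ioo.prod measurableSet_Ioo),
    Measure.restrict_restrict (measurableSet_Ioo.prod measurableSet_Ioo), polarCoord_target,
    Set.prod_inter_prod, Set.inter_eq_left.2 (Set.Ioo_subset_Ioi_self : Set.Ioo (0 : ℝ) 1 ⊆ _),
    Set.inter_eq_left.2 (Set.Ioo_subset_Ioo_left (by linarith [Real.pi_pos]) :
      Set.Ioo 0 Real.pi ⊆ Set.Ioo (-Real.pi) Real.pi),
    lintegral_polar_rect (g := fun α => ENNReal.ofReal (Real.sin α ^ (d - 1)) * g α) (by fun_prop),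
    ← mul_assoc, finrank_euclideanSpace, Fintype.card_fin, ENNReal.mul_inv_cancel (by simp)
    (ENNReal.natCast_ne_top _), one_mul]

/-- A planar cone is measured by its opening angle, since the rest of the integral depends only on
the distance from the origin in the plane. The constant `A` need not be evaluated here: it does not
depend on `S`, so the whole plane determines it later. -/
theorem sphereMeasure_planar_cone (k : ℕ) : ∃ A : ENNReal, ∀ (a b : Space (k + 1)),
    ‖a‖ = 1 → ‖b‖ = 1 → inner ℝ a b = 0 → ∀ S : Set (ℝ × ℝ), MeasurableSet S →
    (∀ r : ℝ, 0 < r → ∀ x y, (r * x, r * y) ∈ S ↔ (x, y) ∈ S) →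
    sphereMeasure (k + 1) {u | (inner ℝ a (u : Space (k + 1)), inner ℝ b (u : Space (k + 1))) ∈ S} =
      A * volume {θ | θ ∈ Set.Ioo (-Real.pi) Real.pi ∧ (Real.cos θ, Real.sin θ) ∈ S} := by
  -- Volume of the slice of the unit ball above a planar point of squared norm `s`.
  let K : ℝ → ENNReal := fun s => ∫⁻ z : EuclideanSpace ℝ (Fin k),
    (Set.Iio (1 : ℝ)).indicator 1 (s + ‖z‖ ^ 2)
  have hK : Measurable K := by
    have : Measurable fun p : ℝ × EuclideanSpace ℝ (Fin k) =>
        (Set.Iio (1 : ℝ)).indicator (1 : ℝ → ENNReal) (p.1 + ‖p.2‖ ^ 2) :=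
      (measurable_one.indicator measurableSet_Iio).comp (by fun_prop)
    exact this.lintegral_prod_right'
  refine ⟨(k + 2 : ℕ) * ∫⁻ ρ in Set.Ioi (0 : ℝ), ENNReal.ofReal ρ * K (ρ ^ 2), ?_⟩
  intro a b ha hb hab S hS hom
  have hind : Measurable (S.indicator (1 : ℝ × ℝ → ENNReal)) := measurable_one.indicator hS
  let g : Space (k + 1) → ENNReal := fun x => S.indicator 1 (inner ℝ a x, inner ℝ b x)
  have hg : Measurable g := hind.comp (by fun_prop)
  let F : ℝ → ℝ → ℝ → ENNReal := fun t s q =>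
    S.indicator 1 (t, s) * (Set.Iio (1 : ℝ)).indicator 1 q
  have hF : Measurable fun p : ℝ × ℝ × ℝ => F p.1 p.2.1 p.2.2 :=
    (hind.comp (f := fun p : ℝ × ℝ × ℝ => (p.1, p.2.1)) (by fun_prop)).mul
      ((measurable_one.indicator measurableSet_Iio).comp (by fun_prop))
  have hSm : MeasurableSet {u : UnitSphere (k + 1) |
      (inner ℝ a (u : Space (k + 1)), inner ℝ b (u : Space (k + 1))) ∈ S} :=
    (show Measurable fun u : UnitSphere (k + 1) =>
      (inner ℝ a (u : Space (k + 1)), inner ℝ b (u : Space (k + 1))) by fun_prop) hS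
  have h0 : sphereMeasure (k + 1)
      {u | (inner ℝ a (u : Space (k + 1)), inner ℝ b (u : Space (k + 1))) ∈ S} =
      ∫⁻ u : UnitSphere (k + 1), g u ∂(sphereMeasure (k + 1)) := by
    rw [← lintegral_indicator_one hSm]
    rfl
  rw [h0]
  unfold sphereMeasure
  rw [lintegral_toSphere volume hg (fun r x hr => by
      simp only [g, inner_smul_right]
      by_cases h : (inner ℝ a x, inner ℝ b x) ∈ S
      · rw [Set.indicator_of_mem h, Set.indicator_of_mem ((hom r hr _ _).2 h)]; rfl
      · rw [Set.indicator_of_notMem h, Set.indicator_of_notMem (fun h' => h ((hom r hr _ _).1 h'))]),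
    ← lintegral_indicator measurableSet_ball]
  have h1 : ∀ x : Space (k + 1), (Metric.ball (0 : Space (k + 1)) 1).indicator g x =
      F (inner ℝ a x) (inner ℝ b x) (‖x‖ ^ 2) := by
    intro x
    by_cases h : ‖x‖ < 1 <;> simp [F, g, Set.indicator, sq_lt_one_iff_abs_lt_one, h]
  simp_rw [h1]
  rw [lintegral_two_coord ha hb hab hF, finrank_euclideanSpace, Fintype.card_fin, mul_assoc]
  congr 1
  have h2 : ∀ p : ℝ × ℝ, ∫⁻ z : EuclideanSpace ℝ (Fin k),
      F p.1 p.2 (p.1 ^ 2 + p.2 ^ 2 + ‖z‖ ^ 2) = S.indicator 1 p * K (p.1 ^ 2 + p.2 ^ 2) := by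
    intro p
    rw [← lintegral_const_mul]
    exact (measurable_one.indicator measurableSet_Iio).comp (by fun_prop)
  simp_rw [h2]
  rw [← lintegral_comp_polarCoord_symm]
  have hT : MeasurableSet {θ : ℝ | (Real.cos θ, Real.sin θ) ∈ S} :=
    (show Measurable fun θ : ℝ => (Real.cos θ, Real.sin θ) by fun_prop) hS
  have h3 : ∀ p ∈ polarCoord.target, ENNReal.ofReal p.1 • (S.indicator 1 (polarCoord.symm p) *
      K ((polarCoord.symm p).1 ^ 2 + (polarCoord.symm p).2 ^ 2)) =
      (ENNReal.ofReal p.1 * K (p.1 ^ 2)) *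
        {θ : ℝ | (Real.cos θ, Real.sin θ) ∈ S}.indicator 1 p.2 := by
    rintro ⟨ρ, θ⟩ hp
    rw [polarCoord_target] at hp
    have hρ : 0 < ρ := hp.1
    simp only [polarCoord_symm_apply]
    have hsq : (ρ * Real.cos θ) ^ 2 + (ρ * Real.sin θ) ^ 2 = ρ ^ 2 := by
      nlinarith [Real.sin_sq_add_cos_sq θ]
    rw [hsq]
    have : S.indicator (1 : ℝ × ℝ → ENNReal) (ρ * Real.cos θ, ρ * Real.sin θ) =
        {θ : ℝ | (Real.cos θ, Real.sin θ) ∈ S}.indicator 1 θ := by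
      by_cases h : (Real.cos θ, Real.sin θ) ∈ S
      · rw [Set.indicator_of_mem ((hom ρ hρ _ _).2 h), Set.indicator_of_mem (by exact h)]
        rfl
      · rw [Set.indicator_of_notMem (fun h' => h ((hom ρ hρ _ _).1 h')),
          Set.indicator_of_notMem (by exact h)]
    rw [this, smul_eq_mul]
    ring
  rw [setLIntegral_congr_fun polarCoord.open_target.measurableSet h3, polarCoord_target,
    Measure.volume_eq_prod, ← Measure.prod_restrict,
    lintegral_prod_mul (f := fun ρ : ℝ => ENNReal.ofReal ρ * K (ρ ^ 2)) (by fun_prop)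
      (measurable_one.indicator hT).aemeasurable, lintegral_indicator_one hT,
    Measure.restrict_apply hT]
  congr 2
  ext θ
  exact and_comm

/-- The second condition is `cos (α - θ) > 0`, so the set lies between the open and the closed
interval from `α - π/2` to `π/2`. -/
theorem volume_angle_lune {α : ℝ} (h0 : 0 ≤ α) (h1 : α ≤ Real.pi) :
    volume {θ : ℝ | θ ∈ Set.Ioo (-Real.pi) Real.pi ∧
      (0 ≤ Real.cos θ ∧ 0 < Real.cos α * Real.cos θ + Real.sin α * Real.sin θ)} =
      ENNReal.ofReal (Real.pi - α) := by
  have hpi := Real.pi_pos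
  have hc : ∀ θ, Real.cos α * Real.cos θ + Real.sin α * Real.sin θ = Real.cos (α - θ) :=
    fun θ => (Real.cos_sub α θ).symm
  simp_rw [hc]
  apply le_antisymm
  · refine (measure_mono (t := Set.Icc (α - Real.pi / 2) (Real.pi / 2)) ?_).trans ?_
    · rintro θ ⟨⟨hθ1, hθ2⟩, hcos, hcos'⟩
      have hle : θ ≤ Real.pi / 2 := by
        by_contra! h
        linarith [Real.cos_neg_of_pi_div_two_lt_of_lt h (by linarith)]
      have hge : -(Real.pi / 2) ≤ θ := by
        by_contra! h
        have := Real.cos_neg_of_pi_div_two_lt_of_lt (x := -θ) (by linarith) (by linarith)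
        rw [Real.cos_neg] at this
        linarith
      refine ⟨?_, hle⟩
      by_contra! h
      linarith [Real.cos_nonpos_of_pi_div_two_le_of_le (x := α - θ) (by linarith) (by linarith)]
    · rw [Real.volume_Icc]
      exact ENNReal.ofReal_le_ofReal (by linarith)
  · refine le_trans ?_ (measure_mono (s := Set.Ioo (α - Real.pi / 2) (Real.pi / 2)) ?_)
    · rw [Real.volume_Ioo]
      exact ENNReal.ofReal_le_ofReal (by linarith)
    · rintro θ ⟨hθ1, hθ2⟩
      exact ⟨⟨by linarith, by linarith⟩, Real.cos_nonneg_of_mem_Icc ⟨by linarith, by linarith⟩,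
        Real.cos_pos_of_mem_Ioo ⟨by linarith, by linarith⟩⟩

theorem exists_orthogonal_unit_decomposition {d : ℕ} (hd : 1 ≤ d) {e : Space d} (he : ‖e‖ = 1)
    (w : Space d) :
    ∃ b : Space d, ‖b‖ = 1 ∧ inner ℝ e b = 0 ∧
      w = (‖w‖ * Real.cos (InnerProductGeometry.angle w e)) • e +
        (‖w‖ * Real.sin (InnerProductGeometry.angle w e)) • b := by
  have hcos : ‖w‖ * Real.cos (InnerProductGeometry.angle w e) = inner ℝ w e := by
    have := InnerProductGeometry.cos_angle_mul_norm_mul_norm w e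
    rw [he] at this
    linarith
  have hsin0 : 0 ≤ ‖w‖ * Real.sin (InnerProductGeometry.angle w e) :=
    mul_nonneg (norm_nonneg _) (InnerProductGeometry.sin_angle_nonneg w e)
  suffices h : ∃ b : Space d, ‖b‖ = 1 ∧ inner ℝ e b = 0 ∧
      ∃ s : ℝ, 0 ≤ s ∧ w = (inner ℝ w e) • e + s • b by
    obtain ⟨b, hb, heb, s, hs, hw⟩ := h
    refine ⟨b, hb, heb, ?_⟩
    have hn : ‖w‖ ^ 2 = (inner ℝ w e) ^ 2 + s ^ 2 := by
      conv_lhs => rw [hw]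
      rw [norm_add_sq_real, norm_smul, norm_smul, he, hb, inner_smul_left, inner_smul_right, heb]
      simp
    have hs' : s = ‖w‖ * Real.sin (InnerProductGeometry.angle w e) := by
      refine (sq_eq_sq₀ hs hsin0).1 ?_
      have := Real.sin_sq_add_cos_sq (InnerProductGeometry.angle w e)
      rw [← hcos] at hn
      nlinarith
    rw [hcos, ← hs']
    exact hw
  set v : Space d := w - (inner ℝ w e) • e with hv
  have hev : inner ℝ e v = 0 := by
    rw [hv, inner_sub_right, inner_smul_right, real_inner_self_eq_norm_sq, he, real_inner_comm]
    ring
  -- If `w` is parallel to `e`, any unit vector orthogonal to `e` serves; one exists because `d ≥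
  -- 1`.
  by_cases hv0 : v = 0
  · have hfin : Module.finrank ℝ (Submodule.span ℝ {e})ᗮ ≠ 0 := by
      have h1 := Submodule.finrank_add_finrank_orthogonal (Submodule.span ℝ {e})
      rw [finrank_span_singleton (by rintro rfl; simp at he)] at h1
      simp only [finrank_euclideanSpace, Fintype.card_fin] at h1
      omega
    have : Nontrivial (Submodule.span ℝ {e})ᗮ :=
      Module.nontrivial_of_finrank_pos (R := ℝ) (Nat.pos_of_ne_zero hfin)
    obtain ⟨⟨b, hb⟩, hb0⟩ := exists_ne (0 : (Submodule.span ℝ {e})ᗮ)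
    have hbne : b ≠ 0 := fun h => hb0 (by ext1; exact h)
    refine ⟨‖b‖⁻¹ • b, by simp [norm_smul, hbne], ?_, 0, le_rfl, ?_⟩
    · rw [inner_smul_right, (Submodule.mem_orthogonal_singleton_iff_inner_right).1 hb, mul_zero]
    · rw [zero_smul, add_zero]
      exact sub_eq_zero.1 hv0
  · have : ‖v‖ ≠ 0 := by simpa using hv0
    refine ⟨‖v‖⁻¹ • v, by simp [norm_smul, hv0], by rw [inner_smul_right, hev, mul_zero],
      ‖v‖, norm_nonneg v, ?_⟩
    rw [smul_smul, mul_inv_cancel₀ this, one_smul, hv]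
    abel

/-- In a plane containing `e` and `w`, the two halfspaces meet in a planar cone of opening `π - α`,
out of `2π` for the full circle; the halfsphere normalisation doubles this fraction. -/
theorem uniformHalfsphere_inner_pos {d : ℕ} (hd : 1 ≤ d) (e : UnitSphere d) {w : Space d}
    (hw : w ≠ 0) :
    uniformHalfsphere e {u | 0 < inner ℝ w (u : Space d)} =
      ENNReal.ofReal (1 - InnerProductGeometry.angle w (e : Space d) / Real.pi) := by
  obtain ⟨k, rfl⟩ : ∃ k, d = k + 1 := ⟨d - 1, by omega⟩
  have he : ‖(e : Space (k + 1))‖ = 1 := by simp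
  obtain ⟨b, hb, heb, hwb⟩ := exists_orthogonal_unit_decomposition hd he w
  set α := InnerProductGeometry.angle w (e : Space (k + 1)) with hα
  have hα0 : 0 ≤ α := InnerProductGeometry.angle_nonneg _ _
  have hα1 : α ≤ Real.pi := InnerProductGeometry.angle_le_pi _ _
  obtain ⟨A, hA⟩ := sphereMeasure_planar_cone k
  have hpi := Real.pi_pos
  -- The full plane yields `A * 2π = ω_{d+1}`.
  have htot := hA e b he hb heb Set.univ .univ (by simp)
  have hIoo : {θ : ℝ | θ ∈ Set.Ioo (-Real.pi) Real.pi ∧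
      (Real.cos θ, Real.sin θ) ∈ (Set.univ : Set (ℝ × ℝ))} = Set.Ioo (-Real.pi) Real.pi := by
    ext; simp
  rw [hIoo, Real.volume_Ioo] at htot
  simp only [Set.mem_univ, Set.ofPred_true] at htot
  rw [show sphereMeasure (k + 1) Set.univ = _ from toSphere_univ_eq_omega (Nat.succ_pos (k + 1))]
    at htot
  have hl := hA e b he hb heb
    {p | 0 ≤ p.1 ∧ 0 < Real.cos α * p.1 + Real.sin α * p.2}
    ((measurableSet_le measurable_const measurable_fst).inter
      (measurableSet_lt (f := fun _ => (0 : ℝ)) measurable_const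
        (g := fun p : ℝ × ℝ => Real.cos α * p.1 + Real.sin α * p.2) (by fun_prop))) (by
      intro r hr x y
      have : Real.cos α * (r * x) + Real.sin α * (r * y) =
        r * (Real.cos α * x + Real.sin α * y) := by ring
      simp only [Set.mem_ofPred_eq, this, mul_pos_iff_of_pos_left hr, mul_nonneg_iff_of_pos_left hr])
  simp only [Set.mem_ofPred_eq] at hl
  rw [volume_angle_lune hα0 hα1] at hl
  have hset : {u : UnitSphere (k + 1) | 0 < inner ℝ w (u : Space (k + 1))} ∩ halfsphere e =
      {u : UnitSphere (k + 1) | 0 ≤ inner ℝ (e : Space (k + 1)) (u : Space (k + 1)) ∧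
        0 < Real.cos α * inner ℝ (e : Space (k + 1)) (u : Space (k + 1)) +
          Real.sin α * inner ℝ b (u : Space (k + 1))} := by
    ext u
    have h1 : inner ℝ w (u : Space (k + 1)) =
        ‖w‖ * (Real.cos α * inner ℝ (e : Space (k + 1)) (u : Space (k + 1)) +
          Real.sin α * inner ℝ b (u : Space (k + 1))) := by
      conv_lhs => rw [hwb]
      rw [inner_add_left, inner_smul_left, inner_smul_left]
      simp only [conj_trivial]
      ring
    simp only [halfsphere, Set.mem_inter_iff, Set.mem_ofPred_eq, h1,
      mul_pos_iff_of_pos_left (norm_pos_iff.2 hw), real_inner_comm (e : Space (k + 1))]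
    exact and_comm
  have hmeas : MeasurableSet {u : UnitSphere (k + 1) | 0 < inner ℝ w (u : Space (k + 1))} :=
    measurableSet_lt measurable_const (by fun_prop)
  have hω := omega_pos (k := k + 1 + 1) (by omega)
  rw [uniformHalfsphere, Measure.smul_apply, Measure.restrict_apply hmeas, hset, hl, smul_eq_mul]
  have hA' : A = ENNReal.ofReal (omega (k + 1 + 1) / (2 * Real.pi)) := by
    rw [ENNReal.ofReal_div_of_pos (by positivity), htot,
      show Real.pi - -Real.pi = 2 * Real.pi by ring, ENNReal.mul_div_cancel_right]
    · simpa using hpi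
    · exact ENNReal.ofReal_ne_top
  rw [hA', ← ENNReal.ofReal_mul (by positivity), ← ENNReal.ofReal_mul (by positivity)]
  congr 1
  field_simp

/-! ### Normals of hyperplanes via determinants. -/

/-- The determinant form of `ℝ^(d+1)`. -/
def detForm (d : ℕ) : Space d [⋀^Fin (d + 1)]→ₗ[ℝ] ℝ :=
  (EuclideanSpace.basisFun (Fin (d + 1)) ℝ).toBasis.det

/-- The cross product of `d` vectors of `ℝ^(d+1)`. -/
def normalVec {d : ℕ} (x : Fin d → Space d) : Space d :=
  WithLp.toLp 2 fun i => detForm d (Fin.cons (EuclideanSpace.basisFun (Fin (d + 1)) ℝ i) x)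

theorem inner_normalVec {d : ℕ} (x : Fin d → Space d) (y : Space d) :
    inner ℝ (normalVec x) y = detForm d (Fin.cons y x) := by
  let φ : Space d →ₗ[ℝ] ℝ := (detForm d).toMultilinearMap.toLinearMap (Fin.cons 0 x) 0
  have hφ : ∀ y, φ y = detForm d (Fin.cons y x) := by
    intro y
    simp only [φ, MultilinearMap.toLinearMap_apply, Fin.update_cons_zero]
    rfl
  have h : (innerₛₗ ℝ (normalVec x) : Space d →ₗ[ℝ] ℝ) = φ := by
    refine (EuclideanSpace.basisFun (Fin (d + 1)) ℝ).toBasis.ext fun i => ?_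
    rw [hφ]
    simp [normalVec, EuclideanSpace.inner_single_right]
  rw [← hφ, ← h]
  rfl

theorem detForm_ne_zero_iff {d : ℕ} {v : Fin (d + 1) → Space d} :
    detForm d v ≠ 0 ↔ LinearIndependent ℝ v := by
  constructor
  · intro h
    by_contra h'
    exact h ((detForm d).map_linearDependent v h')
  · intro h
    have hs : Submodule.span ℝ (Set.range v) = ⊤ :=
      h.span_eq_top_of_card_eq_finrank' (by simp)
    exact (((EuclideanSpace.basisFun (Fin (d + 1)) ℝ).toBasis.is_basis_iff_det).1 ⟨h, hs⟩).ne_zero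

theorem normalVec_ne_zero {d : ℕ} {x : Fin d → Space d} (hx : LinearIndependent ℝ x) :
    normalVec x ≠ 0 := by
  obtain ⟨y, hy⟩ : ∃ y, y ∉ Submodule.span ℝ (Set.range x) := by
    by_contra! h
    have h1 : Submodule.span ℝ (Set.range x) = ⊤ := eq_top_iff.2 fun y _ => h y
    have h2 := finrank_span_eq_card hx
    rw [h1, finrank_top] at h2
    simp at h2
  have h := detForm_ne_zero_iff.2 (linearIndependent_finCons.2 ⟨hx, hy⟩)
  rw [← inner_normalVec] at h
  rintro h0
  simp [h0] at h

theorem inner_normalVec_eq_zero_iff {d : ℕ} {x : Fin d → Space d} (hx : LinearIndependent ℝ x)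
    (y : Space d) :
    inner ℝ (normalVec x) y = 0 ↔ y ∈ Submodule.span ℝ (Set.range x) := by
  rw [inner_normalVec, ← not_iff_not, ← ne_eq, detForm_ne_zero_iff, linearIndependent_finCons]
  simp [hx]

/-- Used with signs `c i = ±1`, when points are replaced by their antipodes. -/
theorem normalVec_smul {d : ℕ} (c : Fin d → ℝ) (x : Fin d → Space d) :
    normalVec (fun i => c i • x i) = (∏ i, c i) • normalVec x := by
  refine ext_inner_right ℝ fun y => ?_
  rw [inner_smul_left, inner_normalVec, inner_normalVec]
  have h := (detForm d).toMultilinearMap.map_smul_univ (Fin.cons 1 c) (Fin.cons y x)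
  simp only [Fin.prod_univ_succ, Fin.cons_zero, Fin.cons_succ, one_mul] at h
  have h' : (fun i : Fin (d + 1) => (Fin.cons 1 c : Fin (d + 1) → ℝ) i •
      (Fin.cons y x : Fin (d + 1) → Space d) i) = Fin.cons y (fun i => c i • x i) := by
    funext i
    refine Fin.cases ?_ (fun j => ?_) i <;> simp
  rw [h'] at h
  exact h

/-- The factor is `det R`; only its being nonzero matters, since angles enter only through functions
symmetric under `α ↦ π - α`. -/
theorem normalVec_map {d : ℕ} (R : Space d ≃ₗᵢ[ℝ] Space d) :
    ∃ c : ℝ, c ≠ 0 ∧ ∀ x : Fin d → Space d,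
      normalVec (fun i => R (x i)) = c • R (normalVec x) := by
  refine ⟨LinearMap.det (R.toLinearEquiv : Space d →ₗ[ℝ] Space d),
    (R.toLinearEquiv.isUnit_det').ne_zero, fun x => ?_⟩
  refine ext_inner_right ℝ fun y => ?_
  obtain ⟨z, rfl⟩ := R.surjective y
  rw [inner_smul_left, R.inner_map_map, inner_normalVec, inner_normalVec]
  have h := (EuclideanSpace.basisFun (Fin (d + 1)) ℝ).toBasis.det_comp
    (R.toLinearEquiv : Space d →ₗ[ℝ] Space d) (Fin.cons z x)
  have h' : (R.toLinearEquiv : Space d →ₗ[ℝ] Space d) ∘ (Fin.cons z x : Fin (d + 1) → Space d) =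
      Fin.cons (R z) fun i => R (x i) := by
    funext i
    refine Fin.cases ?_ (fun j => ?_) i <;> simp
  rw [h'] at h
  exact h

theorem continuous_detForm (d : ℕ) : Continuous fun v : Fin (d + 1) → Space d => detForm d v := by
  unfold detForm
  simp only [Module.Basis.det_apply]
  refine Continuous.matrix_det ?_
  refine continuous_pi fun i => continuous_pi fun j => ?_
  simp only [Module.Basis.toMatrix_apply, OrthonormalBasis.coe_toBasis_repr_apply,
    EuclideanSpace.basisFun_repr]
  fun_prop

theorem continuous_normalVec (d : ℕ) : Continuous (normalVec : (Fin d → Space d) → Space d) := by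
  unfold normalVec
  refine (PiLp.continuous_toLp 2 _).comp (continuous_pi fun i => ?_)
  refine (continuous_detForm d).comp (continuous_pi fun j => ?_)
  refine Fin.cases ?_ (fun k => ?_) j
  · simpa using continuous_const
  · simpa using continuous_apply k

/-! ### Invariance of the spherical measure, and folding onto the halfsphere. -/

/-- The action of a linear isometry on the unit sphere. -/
def sphereMap {d : ℕ} (R : Space d ≃ₗᵢ[ℝ] Space d) (u : UnitSphere d) : UnitSphere d :=
  ⟨R u, by simp⟩

theorem measurable_sphereMap {d : ℕ} (R : Space d ≃ₗᵢ[ℝ] Space d) : Measurable (sphereMap R) :=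
  (R.continuous.measurable.comp measurable_subtype_coe).subtype_mk

open scoped Pointwise in
theorem measurePreserving_sphereMap {d : ℕ} (R : Space d ≃ₗᵢ[ℝ] Space d) :
    MeasurePreserving (sphereMap R) (sphereMeasure d) (sphereMeasure d) := by
  refine ⟨measurable_sphereMap R, Measure.ext fun s hs => ?_⟩
  rw [Measure.map_apply (measurable_sphereMap R) hs, sphereMeasure,
    Measure.toSphere_apply' _ hs, Measure.toSphere_apply' _ (measurable_sphereMap R hs),
    ← R.measurePreserving.measure_preimage_emb R.toHomeomorph.measurableEmbedding
      (Set.Ioo (0 : ℝ) 1 • (((↑) : UnitSphere d → Space d) '' s))]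
  congr 2
  ext x
  simp only [Set.mem_smul, Set.mem_image, Set.mem_preimage]
  constructor
  · rintro ⟨r, hr, _, ⟨u, hu, rfl⟩, rfl⟩
    exact ⟨r, hr, _, ⟨_, hu, rfl⟩, by simp [sphereMap]⟩
  · rintro ⟨r, hr, _, ⟨u, hu, rfl⟩, h⟩
    refine ⟨r, hr, _, ⟨sphereMap R.symm u, ?_, rfl⟩, ?_⟩
    · convert hu
      ext1
      simp [sphereMap]
    · refine R.injective ?_
      rw [← h]
      simp [sphereMap]

theorem sphereMeasure_submodule {d : ℕ} (V : Submodule ℝ (Space d)) (hV : V ≠ ⊤) :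
    sphereMeasure d {u | (u : Space d) ∈ V} = 0 := by
  have hm : MeasurableSet {u : UnitSphere d | (u : Space d) ∈ V} :=
    measurable_subtype_coe V.closed_of_finiteDimensional.measurableSet
  rw [sphereMeasure, Measure.toSphere_apply' _ hm]
  refine mul_eq_zero_of_right _ (measure_mono_null ?_ (Measure.addHaar_submodule volume V hV))
  rintro _ ⟨r, -, _, ⟨u, hu, rfl⟩, rfl⟩
  exact V.smul_mem r hu

/-- The uniform probability measure on the sphere. -/
def uniformSphere (d : ℕ) : Measure (UnitSphere d) :=
  ENNReal.ofReal (1 / omega (d + 1)) • sphereMeasure d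

instance (d : ℕ) : IsProbabilityMeasure (uniformSphere d) := by
  constructor
  have hω := omega_pos (k := d + 1) (by omega)
  rw [uniformSphere, Measure.smul_apply, sphereMeasure, toSphere_univ_eq_omega (Nat.succ_pos d),
    smul_eq_mul, ← ENNReal.ofReal_mul (by positivity), one_div_mul_cancel hω.ne',
    ENNReal.ofReal_one]

/-- The reflection of the sphere onto the halfsphere with pole `e` along lines through `0`. -/
def foldTo {d : ℕ} (e u : UnitSphere d) : UnitSphere d :=
  if 0 ≤ inner ℝ (u : Space d) (e : Space d) then u else -u

theorem measurableSet_halfsphere {d : ℕ} (e : UnitSphere d) : MeasurableSet (halfsphere e) :=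
  measurableSet_le measurable_const (by fun_prop)

theorem measurable_neg_sphere (d : ℕ) : Measurable (fun u : UnitSphere d => -u) :=
  (measurable_subtype_coe.neg).subtype_mk

theorem measurable_foldTo {d : ℕ} (e : UnitSphere d) : Measurable (foldTo e) :=
  Measurable.ite (measurableSet_halfsphere e) measurable_id (measurable_neg_sphere d)

theorem measurePreserving_neg_sphere (d : ℕ) :
    MeasurePreserving (fun u : UnitSphere d => -u) (sphereMeasure d) (sphereMeasure d) := by
  convert measurePreserving_sphereMap (LinearIsometryEquiv.neg ℝ (E := Space d)) using 1
  funext u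
  ext1
  simp [sphereMap]

theorem sphereMeasure_equator {d : ℕ} (e : UnitSphere d) :
    sphereMeasure d {u | inner ℝ (u : Space d) (e : Space d) = 0} = 0 := by
  have h := sphereMeasure_submodule (Submodule.span ℝ {(e : Space d)})ᗮ (by
    intro h
    rw [Submodule.orthogonal_eq_top_iff, Submodule.span_singleton_eq_bot] at h
    have := e.2
    simp [h] at this)
  simpa [Submodule.mem_orthogonal_singleton_iff_inner_left] using h

theorem map_foldTo {d : ℕ} (e : UnitSphere d) :
    (uniformSphere d).map (foldTo e) = uniformHalfsphere e := by
  refine Measure.ext fun s hs => ?_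
  rw [Measure.map_apply (measurable_foldTo e) hs, uniformSphere, uniformHalfsphere,
    Measure.smul_apply, Measure.smul_apply, Measure.restrict_apply hs,
    ← measure_inter_add_sdiff _ (measurableSet_halfsphere e)]
  have h1 : foldTo e ⁻¹' s ∩ halfsphere e = s ∩ halfsphere e := by
    ext u
    simp only [Set.mem_inter_iff, Set.mem_preimage, foldTo, halfsphere, Set.mem_ofPred_eq]
    refine and_congr_left fun h => ?_
    rw [if_pos h]
  have h2 : sphereMeasure d (foldTo e ⁻¹' s \ halfsphere e) = sphereMeasure d (s ∩ halfsphere e) := by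
    -- Points outside the halfsphere are the antipodes of its points off the equator; the equator is
    -- null, so both halves of the preimage have equal measure.
    have h3 : foldTo e ⁻¹' s \ halfsphere e = (fun u : UnitSphere d => -u) ⁻¹'
        ((s ∩ halfsphere e) \ {u | inner ℝ (u : Space d) (e : Space d) = 0}) := by
      ext u
      simp only [Set.mem_sdiff, Set.mem_inter_iff, Set.mem_preimage, foldTo, halfsphere,
        Set.mem_ofPred_eq, coe_neg_sphere, inner_neg_left, neg_eq_zero, Left.nonneg_neg_iff]
      constructor
      · rintro ⟨h, h'⟩
        rw [if_neg h'] at h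
        exact ⟨⟨h, (not_le.1 h').le⟩, (not_le.1 h').ne⟩
      · rintro ⟨⟨h, h'⟩, h''⟩
        have h4 := not_le.2 (lt_of_le_of_ne h' h'')
        exact ⟨by rwa [if_neg h4], h4⟩
    rw [h3, (measurePreserving_neg_sphere d).measure_preimage
      ((hs.inter (measurableSet_halfsphere e)).diff
        (measurableSet_eq_fun (by fun_prop) measurable_const)).nullMeasurableSet,
      measure_sdiff_null (sphereMeasure_equator e)]
  have h3 : ENNReal.ofReal (2 / omega (d + 1)) = ENNReal.ofReal (1 / omega (d + 1)) * 2 := by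
    rw [← ENNReal.ofReal_ofNat 2, ← ENNReal.ofReal_mul' (by norm_num)]
    congr 1
    ring
  rw [h1, h2, ← two_mul, smul_eq_mul, smul_eq_mul, h3, mul_assoc]

instance {d : ℕ} (e : UnitSphere d) : IsProbabilityMeasure (uniformHalfsphere e) := by
  rw [← map_foldTo e]
  exact Measure.isProbabilityMeasure_map (measurable_foldTo e).aemeasurable

theorem uniformHalfsphere_submodule {d : ℕ} (e : UnitSphere d) (V : Submodule ℝ (Space d))
    (hV : V ≠ ⊤) : uniformHalfsphere e {u | (u : Space d) ∈ V} = 0 := by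
  rw [uniformHalfsphere, Measure.smul_apply]
  exact smul_eq_zero_of_right _ (Measure.restrict_le_self.absolutelyContinuous
    (sphereMeasure_submodule V hV))

theorem uniformSphere_submodule {d : ℕ} (V : Submodule ℝ (Space d)) (hV : V ≠ ⊤) :
    uniformSphere d {u | (u : Space d) ∈ V} = 0 := by
  rw [uniformSphere, Measure.smul_apply]
  exact smul_eq_zero_of_right _ (sphereMeasure_submodule V hV)

/-! ### Almost sure independence, and the law of the angle between normal and pole. -/

theorem ae_linearIndependent {d : ℕ} {ρ : Measure (UnitSphere d)} [IsProbabilityMeasure ρ]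
    (hρ : ∀ V : Submodule ℝ (Space d), V ≠ ⊤ → ρ {u | (u : Space d) ∈ V} = 0) {k : ℕ}
    (hk : k ≤ d + 1) :
    ∀ᵐ x ∂Measure.pi fun _ : Fin k => ρ, LinearIndependent ℝ fun i => (x i : Space d) := by
  induction k with
  | zero => exact Filter.Eventually.of_forall fun x => linearIndependent_empty_type
  | succ k ih =>
    have hmeas : MeasurableSet {x : Fin (k + 1) → UnitSphere d |
        LinearIndependent ℝ fun i => (x i : Space d)} :=
      (isOpen_setOfPred_linearIndependent.preimage
        (f := fun (x : Fin (k + 1) → UnitSphere d) i => (x i : Space d))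
          (by fun_prop)).measurableSet
    have hmp := ((measurePreserving_piFinSuccAbove (fun _ : Fin (k + 1) => ρ) 0).symm).comp
      (Measure.measurePreserving_swap (μ := Measure.pi fun _ : Fin k => ρ) (ν := ρ))
    rw [← hmp.map_eq, ae_map_iff hmp.measurable.aemeasurable hmeas]
    refine (Measure.ae_prod_iff_ae_ae (hmp.measurable hmeas)).2 ?_
    filter_upwards [ih (by omega)] with x hx
    have hV : Submodule.span ℝ (Set.range fun i => (x i : Space d)) ≠ ⊤ := by
      intro h
      have h2 := finrank_span_eq_card hx
      rw [h, finrank_top] at h2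
      simp at h2
      omega
    have h0 := hρ _ hV
    rw [measure_eq_zero_iff_ae_notMem] at h0
    filter_upwards [h0] with y hy
    have heq : (fun i => (((MeasurableEquiv.piFinSuccAbove (fun _ : Fin (k + 1) => UnitSphere d)
        0).symm (y, x)) i : Space d)) = Fin.cons (y : Space d) fun i => (x i : Space d) := by
      funext i
      refine Fin.cases ?_ (fun j => ?_) i <;>
        simp [MeasurableEquiv.piFinSuccAbove, Fin.insertNthEquiv, Fin.insertNth_zero']
    change LinearIndependent ℝ (fun i => (((MeasurableEquiv.piFinSuccAbove
      (fun _ : Fin (k + 1) => UnitSphere d) 0).symm (y, x)) i : Space d))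
    rw [heq, linearIndependent_finCons]
    exact ⟨hx, hy⟩

theorem measurePreserving_sphereMap_uniform {d : ℕ} (R : Space d ≃ₗᵢ[ℝ] Space d) :
    MeasurePreserving (sphereMap R) (uniformSphere d) (uniformSphere d) :=
  ⟨measurable_sphereMap R, by
    rw [uniformSphere, Measure.map_smul, (measurePreserving_sphereMap R).map_eq]⟩

theorem lintegral_angle_uniformSphere {d : ℕ} (hd : 1 ≤ d) {w : Space d} (hw : w ≠ 0)
    {g : ℝ → ENNReal} (hg : Measurable g) :
    ∫⁻ u : UnitSphere d, g (InnerProductGeometry.angle w (u : Space d)) ∂(uniformSphere d) =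
      ENNReal.ofReal (omega d / omega (d + 1)) * ∫⁻ α in Set.Ioo (0 : ℝ) Real.pi,
        ENNReal.ofReal (Real.sin α ^ (d - 1)) * g α := by
  have hω := omega_pos (k := d + 1) (by omega)
  have h1 : ∀ u : Space d, InnerProductGeometry.angle w u =
      InnerProductGeometry.angle (‖w‖⁻¹ • w) u := fun u =>
    (InnerProductGeometry.angle_smul_left_of_pos _ _ (by positivity)).symm
  simp_rw [h1]
  rw [uniformSphere, lintegral_smul_measure, lintegral_angle hd (by simp [norm_smul, hw]) hg,
    smul_eq_mul, ← mul_assoc, ← ENNReal.ofReal_mul (by positivity)]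
  congr 2
  ring

theorem apply_angle_smul_left {d : ℕ} {g : ℝ → ENNReal} (hs : ∀ α, g (Real.pi - α) = g α) {c : ℝ}
    (hc : c ≠ 0) (v e : Space d) :
    g (InnerProductGeometry.angle (c • v) e) = g (InnerProductGeometry.angle v e) := by
  rcases lt_or_gt_of_ne hc with h | h
  · rw [InnerProductGeometry.angle_smul_left_of_neg _ _ h, InnerProductGeometry.angle_neg_left, hs]
  · rw [InnerProductGeometry.angle_smul_left_of_pos _ _ h]

theorem measurable_angle {α : Type*} [MeasurableSpace α] {d : ℕ} {f g : α → Space d}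
    (hf : Measurable f) (hg : Measurable g) :
    Measurable fun a => InnerProductGeometry.angle (f a) (g a) := by
  unfold InnerProductGeometry.angle
  exact Real.continuous_arccos.measurable.comp ((hf.inner hg).div (hf.norm.mul hg.norm))

theorem measurable_angle_normalVec (d : ℕ) :
    Measurable fun p : (Fin d → UnitSphere d) × UnitSphere d =>
      InnerProductGeometry.angle (normalVec fun i => (p.1 i : Space d)) (p.2 : Space d) :=
  measurable_angle ((continuous_normalVec d).measurable.comp (by fun_prop)) (by fun_prop)

theorem measurable_angle_normalVec_left {d : ℕ} (e : UnitSphere d) :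
    Measurable fun x : Fin d → UnitSphere d =>
      InnerProductGeometry.angle (normalVec fun i => (x i : Space d)) (e : Space d) :=
  measurable_angle ((continuous_normalVec d).measurable.comp (by fun_prop)) measurable_const

/-- The reflection taking `e` to `e'` preserves the product measure and maps normals to normals up
to a nonzero factor, which `g` does not see by symmetry. -/
theorem lintegral_angle_normalVec_pole {d : ℕ} {g : ℝ → ENNReal} (hg : Measurable g)
    (hs : ∀ α, g (Real.pi - α) = g α) (e e' : UnitSphere d) :
    ∫⁻ x, g (InnerProductGeometry.angle (normalVec fun i => (x i : Space d)) (e : Space d))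
        ∂(Measure.pi fun _ : Fin d => uniformSphere d) =
      ∫⁻ x, g (InnerProductGeometry.angle (normalVec fun i => (x i : Space d)) (e' : Space d))
        ∂(Measure.pi fun _ : Fin d => uniformSphere d) := by
  let R : Space d ≃ₗᵢ[ℝ] Space d := (ℝ ∙ ((e : Space d) - e'))ᗮ.reflection
  have hR : R e = e' := Submodule.reflection_sub (by simp)
  have hmp := measurePreserving_pi (fun _ : Fin d => uniformSphere d)
    (fun _ : Fin d => uniformSphere d) (f := fun _ => sphereMap R)
    fun _ => measurePreserving_sphereMap_uniform R
  have hm : Measurable fun x : Fin d → UnitSphere d =>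
      g (InnerProductGeometry.angle (normalVec fun i => (x i : Space d)) (e' : Space d)) :=
    hg.comp (measurable_angle_normalVec_left e')
  rw [← hmp.lintegral_comp hm]
  refine lintegral_congr fun x => ?_
  obtain ⟨c, hc, hcR⟩ := normalVec_map R
  have h1 : (normalVec fun i => (sphereMap R (x i) : Space d)) =
      c • R (normalVec fun i => (x i : Space d)) := hcR fun i => (x i : Space d)
  rw [h1, apply_angle_smul_left hs hc, ← hR, ← R.toLinearIsometry.angle_map]
  rfl

/-- The integral does not depend on the pole, so it equals its average over poles. Exchanging the
integrals leaves a fixed, almost surely nonzero normal and a uniform pole; the law of the normal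
itself is never computed. -/
theorem lintegral_angle_normalVec_uniformSphere {d : ℕ} (hd : 1 ≤ d) {g : ℝ → ENNReal}
    (hg : Measurable g) (hs : ∀ α, g (Real.pi - α) = g α) (e : UnitSphere d) :
    ∫⁻ x, g (InnerProductGeometry.angle (normalVec fun i => (x i : Space d)) (e : Space d))
        ∂(Measure.pi fun _ : Fin d => uniformSphere d) =
      ENNReal.ofReal (omega d / omega (d + 1)) * ∫⁻ α in Set.Ioo (0 : ℝ) Real.pi,
        ENNReal.ofReal (Real.sin α ^ (d - 1)) * g α := by
  have hm := hg.comp (measurable_angle_normalVec d)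
  calc
    _ = ∫⁻ _ : UnitSphere d, (∫⁻ x, g (InnerProductGeometry.angle
          (normalVec fun i => (x i : Space d)) (e : Space d))
          ∂(Measure.pi fun _ : Fin d => uniformSphere d)) ∂uniformSphere d := by simp
    _ = ∫⁻ e' : UnitSphere d, (∫⁻ x, g (InnerProductGeometry.angle
          (normalVec fun i => (x i : Space d)) (e' : Space d))
          ∂(Measure.pi fun _ : Fin d => uniformSphere d)) ∂uniformSphere d :=
      lintegral_congr fun e' => lintegral_angle_normalVec_pole hg hs e e'
    _ = ∫⁻ x, (∫⁻ e' : UnitSphere d, g (InnerProductGeometry.angle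
          (normalVec fun i => (x i : Space d)) (e' : Space d)) ∂uniformSphere d)
          ∂(Measure.pi fun _ : Fin d => uniformSphere d) :=
      lintegral_lintegral_swap (hm.comp measurable_swap).aemeasurable
    _ = ∫⁻ _, (ENNReal.ofReal (omega d / omega (d + 1)) * ∫⁻ α in Set.Ioo (0 : ℝ) Real.pi,
          ENNReal.ofReal (Real.sin α ^ (d - 1)) * g α)
          ∂(Measure.pi fun _ : Fin d => uniformSphere d) := by
      refine lintegral_congr_ae ?_
      filter_upwards [ae_linearIndependent (k := d) (uniformSphere_submodule (d := d)) (by omega)]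
        with x hx
      exact lintegral_angle_uniformSphere hd (normalVec_ne_zero hx) hg
    _ = _ := by simp

theorem lintegral_angle_normalVec {d : ℕ} (hd : 1 ≤ d) {g : ℝ → ENNReal}
    (hg : Measurable g) (hs : ∀ α, g (Real.pi - α) = g α) (e : UnitSphere d) :
    ∫⁻ x, g (InnerProductGeometry.angle (normalVec fun i => (x i : Space d)) (e : Space d))
        ∂(Measure.pi fun _ : Fin d => uniformHalfsphere e) =
      ENNReal.ofReal (omega d / omega (d + 1)) * ∫⁻ α in Set.Ioo (0 : ℝ) Real.pi,
        ENNReal.ofReal (Real.sin α ^ (d - 1)) * g α := by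
  have hm : Measurable fun x : Fin d → UnitSphere d =>
      g (InnerProductGeometry.angle (normalVec fun i => (x i : Space d)) (e : Space d)) :=
    hg.comp (measurable_angle_normalVec_left e)
  have hmp := measurePreserving_pi (fun _ : Fin d => uniformSphere d)
    (fun _ : Fin d => uniformHalfsphere e) (f := fun _ => foldTo e)
    fun _ => ⟨measurable_foldTo e, map_foldTo e⟩
  rw [← lintegral_angle_normalVec_uniformSphere hd hg hs e, ← hmp.lintegral_comp hm]
  refine lintegral_congr fun x => ?_
  have h1 : ∀ u : UnitSphere d, ∃ c : ℝ, c ≠ 0 ∧ (foldTo e u : Space d) = c • (u : Space d) := by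
    intro u
    unfold foldTo
    split_ifs
    · exact ⟨1, one_ne_zero, by simp⟩
    · exact ⟨-1, by simp, by simp⟩
  choose c hc hcu using h1
  have h2 : (fun i => (foldTo e (x i) : Space d)) = fun i => c (x i) • (x i : Space d) :=
    funext fun i => hcu (x i)
  rw [h2, normalVec_smul, apply_angle_smul_left hs (Finset.prod_ne_zero_iff.2 fun i _ => hc _)]

/-! ### The probability that the remaining points lie on one side. -/

/-- All points `y j` lie strictly on the same side of the hyperplane spanned by the `x i`. -/
def OneSided {d m : ℕ} (x : Fin d → UnitSphere d) (y : Fin m → UnitSphere d) : Prop :=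
  (∀ j, 0 < inner ℝ (normalVec fun i => (x i : Space d)) (y j : Space d)) ∨
    ∀ j, inner ℝ (normalVec fun i => (x i : Space d)) (y j : Space d) < 0

theorem measurableSet_oneSided (d m : ℕ) :
    MeasurableSet {p : (Fin d → UnitSphere d) × (Fin m → UnitSphere d) | OneSided p.1 p.2} := by
  have hn : Measurable fun p : (Fin d → UnitSphere d) × (Fin m → UnitSphere d) =>
      normalVec fun i => (p.1 i : Space d) :=
    (continuous_normalVec d).measurable.comp (by fun_prop)
  have hi : ∀ j, Measurable fun p : (Fin d → UnitSphere d) × (Fin m → UnitSphere d) =>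
      inner ℝ (normalVec fun i => (p.1 i : Space d)) (p.2 j : Space d) :=
    fun j => hn.inner (by fun_prop)
  have h : {p : (Fin d → UnitSphere d) × (Fin m → UnitSphere d) | OneSided p.1 p.2} =
      (⋂ j, {p | 0 < inner ℝ (normalVec fun i => (p.1 i : Space d)) (p.2 j : Space d)}) ∪
        ⋂ j, {p | inner ℝ (normalVec fun i => (p.1 i : Space d)) (p.2 j : Space d) < 0} := by
    ext p
    simp [OneSided]
  rw [h]
  exact (MeasurableSet.iInter fun j => measurableSet_lt measurable_const (hi j)).union
    (MeasurableSet.iInter fun j => measurableSet_lt (hi j) measurable_const)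

theorem pi_oneSided {d m : ℕ} (hd : 1 ≤ d) (hm : 1 ≤ m) (e : UnitSphere d)
    {x : Fin d → UnitSphere d} (hx : LinearIndependent ℝ fun i => (x i : Space d)) :
    Measure.pi (fun _ : Fin m => uniformHalfsphere e) {y | OneSided x y} =
      ENNReal.ofReal (1 - InnerProductGeometry.angle (normalVec fun i => (x i : Space d))
        (e : Space d) / Real.pi) ^ m +
      ENNReal.ofReal (InnerProductGeometry.angle (normalVec fun i => (x i : Space d))
        (e : Space d) / Real.pi) ^ m := by
  set w := normalVec fun i => (x i : Space d) with hw
  have hw0 : w ≠ 0 := normalVec_ne_zero hx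
  have h1 : {y : Fin m → UnitSphere d | OneSided x y} =
      (Set.univ.pi fun _ => {u : UnitSphere d | 0 < inner ℝ w (u : Space d)}) ∪
        (Set.univ.pi fun _ => {u : UnitSphere d | inner ℝ w (u : Space d) < 0}) := by
    ext y
    simp [OneSided, Set.mem_pi, ← hw]
  have hneg : {u : UnitSphere d | inner ℝ w (u : Space d) < 0} =
      {u : UnitSphere d | 0 < inner ℝ (-w) (u : Space d)} := by
    ext u
    simp
  rw [h1, measure_union, Measure.pi_pi, Measure.pi_pi, hneg, uniformHalfsphere_inner_pos hd e hw0,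
    uniformHalfsphere_inner_pos hd e (neg_ne_zero.2 hw0), InnerProductGeometry.angle_neg_left]
  · have hpi := Real.pi_ne_zero
    simp only [Finset.prod_const, Finset.card_univ, Fintype.card_fin]
    congr 3
    field_simp
    ring
  -- Disjointness needs `m ≥ 1`: without points both alternatives hold vacuously.
  · rw [Set.disjoint_left]
    intro y hy hy'
    have h2 : 0 < inner ℝ w (y ⟨0, hm⟩ : Space d) := hy ⟨0, hm⟩ trivial
    have h3 : inner ℝ w (y ⟨0, hm⟩ : Space d) < 0 := hy' ⟨0, hm⟩ trivial
    exact lt_asymm h2 h3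
  · exact MeasurableSet.univ_pi fun _ => measurableSet_lt (by fun_prop) measurable_const

theorem lintegral_sin_pow_mul (d m : ℕ) :
    ∫⁻ α in Set.Ioo (0 : ℝ) Real.pi, ENNReal.ofReal (Real.sin α ^ (d - 1)) *
      (ENNReal.ofReal (1 - α / Real.pi) ^ m + ENNReal.ofReal (α / Real.pi) ^ m) =
      ENNReal.ofReal (2 * ∫ α in (0 : ℝ)..Real.pi,
        (1 - α / Real.pi) ^ m * Real.sin α ^ (d - 1)) := by
  have hpi := Real.pi_pos
  have hcont : Continuous fun α : ℝ =>
      Real.sin α ^ (d - 1) * ((1 - α / Real.pi) ^ m + (α / Real.pi) ^ m) := by fun_prop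
  have h1 : ∀ α ∈ Set.Ioo (0 : ℝ) Real.pi, ENNReal.ofReal (Real.sin α ^ (d - 1)) *
      (ENNReal.ofReal (1 - α / Real.pi) ^ m + ENNReal.ofReal (α / Real.pi) ^ m) =
      ENNReal.ofReal (Real.sin α ^ (d - 1) * ((1 - α / Real.pi) ^ m + (α / Real.pi) ^ m)) := by
    intro α hα
    have h2 : 0 ≤ 1 - α / Real.pi := by
      rw [sub_nonneg, div_le_one hpi]; exact hα.2.le
    have h3 : 0 ≤ α / Real.pi := div_nonneg hα.1.le hpi.le
    rw [← ENNReal.ofReal_pow h2, ← ENNReal.ofReal_pow h3,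
      ← ENNReal.ofReal_add (by positivity) (by positivity), ← ENNReal.ofReal_mul
      (pow_nonneg (Real.sin_nonneg_of_nonneg_of_le_pi hα.1.le hα.2.le) _)]
  rw [setLIntegral_congr_fun measurableSet_Ioo h1, ← ofReal_integral_eq_lintegral_ofReal]
  · congr 1
    rw [← integral_Ioc_eq_integral_Ioo, ← intervalIntegral.integral_of_le hpi.le]
    -- The reflection `α ↦ π - α` identifies the two summands, whence the factor 2.
    have h4 : ∫ α in (0 : ℝ)..Real.pi, Real.sin α ^ (d - 1) * (α / Real.pi) ^ m =
        ∫ α in (0 : ℝ)..Real.pi, (1 - α / Real.pi) ^ m * Real.sin α ^ (d - 1) := by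
      have h5 := intervalIntegral.integral_comp_sub_left (a := 0) (b := Real.pi)
        (fun α => Real.sin α ^ (d - 1) * (α / Real.pi) ^ m) Real.pi
      simp only [sub_self, sub_zero, Real.sin_pi_sub] at h5
      rw [← h5]
      refine intervalIntegral.integral_congr fun α _ => ?_
      have : (Real.pi - α) / Real.pi = 1 - α / Real.pi := by field_simp
      simp only [this]
      ring
    simp_rw [mul_add]
    rw [intervalIntegral.integral_add, h4, two_mul]
    · congr 1
      exact intervalIntegral.integral_congr fun α _ => mul_comm _ _
    · exact Continuous.intervalIntegrable (by fun_prop) _ _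
    · exact Continuous.intervalIntegrable (by fun_prop) _ _
  · exact (hcont.integrableOn_Icc (a := 0) (b := Real.pi)).mono_set Set.Ioo_subset_Icc_self
  · filter_upwards [ae_restrict_mem measurableSet_Ioo] with α hα
    have h2 : 0 ≤ 1 - α / Real.pi := by
      rw [sub_nonneg, div_le_one hpi]; exact hα.2.le
    have h3 : 0 ≤ α / Real.pi := div_nonneg hα.1.le hpi.le
    have := Real.sin_nonneg_of_nonneg_of_le_pi hα.1.le hα.2.le
    simp only [Pi.zero_apply]
    positivity

theorem prod_oneSided {d m : ℕ} (hd : 1 ≤ d) (hm : 1 ≤ m) (e : UnitSphere d) :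
    ((Measure.pi fun _ : Fin d => uniformHalfsphere e).prod
      (Measure.pi fun _ : Fin m => uniformHalfsphere e)) {p | OneSided p.1 p.2} =
      ENNReal.ofReal (2 * omega d / omega (d + 1) *
        ∫ α in (0 : ℝ)..Real.pi, (1 - α / Real.pi) ^ m * Real.sin α ^ (d - 1)) := by
  have hω := omega_pos (k := d + 1) (by omega)
  have hω' := omega_pos (k := d) (by omega)
  let g : ℝ → ENNReal := fun α =>
    ENNReal.ofReal (1 - α / Real.pi) ^ m + ENNReal.ofReal (α / Real.pi) ^ m
  have hg : Measurable g := by fun_prop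
  have hs : ∀ α, g (Real.pi - α) = g α := by
    intro α
    have hpi := Real.pi_ne_zero
    have h1 : (Real.pi - α) / Real.pi = 1 - α / Real.pi := by field_simp
    simp only [g, h1, sub_sub_cancel]
    exact add_comm _ _
  rw [Measure.prod_apply (measurableSet_oneSided d m)]
  have h1 := lintegral_angle_normalVec hd hg hs e
  rw [lintegral_sin_pow_mul, ← ENNReal.ofReal_mul (by positivity)] at h1
  have h2 : ∀ᵐ x ∂Measure.pi fun _ : Fin d => uniformHalfsphere e,
      Measure.pi (fun _ : Fin m => uniformHalfsphere e)
        (Prod.mk x ⁻¹' {p | OneSided p.1 p.2}) =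
        g (InnerProductGeometry.angle (normalVec fun i => (x i : Space d)) (e : Space d)) := by
    filter_upwards [ae_linearIndependent (k := d) (uniformHalfsphere_submodule e) (by omega)]
      with x hx
    exact pi_oneSided hd hm e hx
  rw [lintegral_congr_ae h2, h1]
  congr 1
  ring

/-! ### Facets of a cone generated by vectors in general position. -/

section Cone

variable {d n : ℕ}

/-- At most `d + 1` of the vectors are always linearly independent. -/
def GeneralPosition (x : Fin n → Space d) : Prop :=
  ∀ s : Finset (Fin n), s.card ≤ d + 1 → LinearIndepOn ℝ x (s : Set (Fin n))

/-- The vectors with index in `I` lie on a hyperplane through `0`, and all others lie strictly on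
one side of it. -/
def Supporting (x : Fin n → Space d) (I : Finset (Fin n)) : Prop :=
  ∃ φ : Space d →ₗ[ℝ] ℝ, (∀ i ∈ I, φ (x i) = 0) ∧ ∀ j ∉ I, 0 < φ (x j)

theorem mem_hull_range {x : Fin n → Space d} {y : Space d}
    (hy : y ∈ PointedCone.hull ℝ (Set.range x)) :
    ∃ c : Fin n → ℝ, (∀ i, 0 ≤ c i) ∧ ∑ i, c i • x i = y := by
  obtain ⟨c, hc⟩ := (Submodule.mem_span_range_iff_exists_fun _).1 hy
  exact ⟨fun i => c i, fun i => (c i).2, hc⟩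

theorem span_hull (s : Set (Space d)) :
    Submodule.span ℝ ((PointedCone.hull ℝ s : PointedCone ℝ (Space d)) : Set (Space d)) =
      Submodule.span ℝ s :=
  Submodule.span_span_of_tower {c : ℝ // 0 ≤ c} ℝ s

theorem map_eq_zero_of_mem_hull {x : Fin n → Space d} {I : Finset (Fin n)}
    {φ : Space d →ₗ[ℝ] ℝ} (h0 : ∀ i ∈ I, φ (x i) = 0) {y : Space d}
    (hy : y ∈ PointedCone.hull ℝ (x '' I)) : φ y = 0 := by
  have h : x '' I ⊆ φ.ker := by
    rintro _ ⟨i, hi, rfl⟩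
    exact h0 i hi
  exact Submodule.span_le.2 h (PointedCone.hull_le_span _ _ hy)

theorem hull_of_supporting {x : Fin n → Space d} {I : Finset (Fin n)} {φ : Space d →ₗ[ℝ] ℝ}
    (h0 : ∀ i ∈ I, φ (x i) = 0) (hpos : ∀ j ∉ I, 0 < φ (x j)) {y : Space d}
    (hy : y ∈ PointedCone.hull ℝ (Set.range x)) :
    0 ≤ φ y ∧ (φ y = 0 → y ∈ PointedCone.hull ℝ (x '' I)) := by
  obtain ⟨c, hc, rfl⟩ := mem_hull_range hy
  have hterm : ∀ i, 0 ≤ c i * φ (x i) := by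
    intro i
    by_cases hi : i ∈ I
    · simp [h0 i hi]
    · exact mul_nonneg (hc i) (hpos i hi).le
  simp only [map_sum, map_smul, smul_eq_mul]
  refine ⟨Finset.sum_nonneg fun i _ => hterm i, fun h => Submodule.sum_mem _ fun i _ => ?_⟩
  by_cases hi : i ∈ I
  · exact PointedCone.smul_mem _ (hc i) (PointedCone.subset_hull ⟨i, hi, rfl⟩)
  · have h1 := (Finset.sum_eq_zero_iff_of_nonneg fun i _ => hterm i).1 h i (Finset.mem_univ i)
    rcases mul_eq_zero.1 h1 with h2 | h2
    · rw [h2, zero_smul]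
      exact Submodule.zero_mem _
    · exact absurd h2 (hpos i hi).ne'

theorem isFaceOf_of_supporting {x : Fin n → Space d} {I : Finset (Fin n)}
    (hI : Supporting x I) :
    (PointedCone.hull ℝ (x '' I)).IsFaceOf (PointedCone.hull ℝ (Set.range x)) := by
  obtain ⟨φ, h0, hpos⟩ := hI
  refine ⟨Submodule.span_mono (Set.image_subset_range _ _), fun {u v a} hu hv ha h => ?_⟩
  have h1 := map_eq_zero_of_mem_hull h0 h
  have h2 := hull_of_supporting h0 hpos hu
  have h3 := hull_of_supporting h0 hpos hv
  rw [map_add, map_smul, smul_eq_mul] at h1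
  refine h2.2 ?_
  have h4 : a * φ u = 0 := by nlinarith [mul_nonneg ha.le h2.1, h3.1]
  exact (mul_eq_zero.1 h4).resolve_left ha.ne'

/-- The index set is recovered from its cone, so distinct supporting sets give distinct facets. -/
theorem mem_hull_image_iff_of_supporting {x : Fin n → Space d} {I : Finset (Fin n)}
    (hI : Supporting x I) (i : Fin n) : x i ∈ PointedCone.hull ℝ (x '' I) ↔ i ∈ I := by
  obtain ⟨φ, h0, hpos⟩ := hI
  refine ⟨fun h => ?_, fun h => PointedCone.subset_hull ⟨i, h, rfl⟩⟩
  by_contra hi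
  exact (hpos i hi).ne' (map_eq_zero_of_mem_hull h0 h)

theorem finrank_span_image {x : Fin n → Space d} (hx : GeneralPosition x) {I : Finset (Fin n)}
    (hI : I.card ≤ d + 1) : Module.finrank ℝ (Submodule.span ℝ (x '' I)) = I.card := by
  have h := (hx I hI).linearIndependent
  have h2 := finrank_span_eq_card h
  simp only [Finset.coe_sort_coe, Fintype.card_coe] at h2
  rw [Set.image_eq_range]
  exact h2

theorem exists_functional {x : Fin n → Space d} (hx : GeneralPosition x) {I : Finset (Fin n)}
    (hI : I.card = d) :
    ∃ φ : Space d →ₗ[ℝ] ℝ, ∀ y, φ y = 0 ↔ y ∈ Submodule.span ℝ (x '' I) := by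
  have hLI : LinearIndependent ℝ (x ∘ I.orderEmbOfFin hI) := by
    rw [← linearIndepOn_range_iff (I.orderEmbOfFin hI).injective, Finset.range_orderEmbOfFin]
    exact hx I (by omega)
  refine ⟨innerₛₗ ℝ (normalVec (x ∘ I.orderEmbOfFin hI)), fun y => ?_⟩
  have h := inner_normalVec_eq_zero_iff hLI y
  rw [Set.range_comp, Finset.range_orderEmbOfFin] at h
  exact h

theorem notMem_span_of_generalPosition {x : Fin n → Space d} (hx : GeneralPosition x)
    {I : Finset (Fin n)} (hI : I.card = d) {j : Fin n} (hj : j ∉ I) :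
    x j ∉ Submodule.span ℝ (x '' I) := by
  have h := hx (insert j I) (by rw [Finset.card_insert_of_notMem hj, hI])
  rw [Finset.coe_insert, linearIndepOn_insert (by simpa using hj)] at h
  exact h.2

/-- A face is generated by the generators it contains, and general position forces exactly `d` of
them. Two other generators on opposite sides of their hyperplane would have a positive combination
inside it, which pulls one of them into the face. -/
theorem exists_supporting_of_isFaceOf {x : Fin n → Space d} (hx : GeneralPosition x)
    {F : PointedCone ℝ (Space d)} (hF : F.IsFaceOf (PointedCone.hull ℝ (Set.range x)))
    (hd : Module.finrank ℝ (Submodule.span ℝ (F : Set (Space d))) = d) :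
    ∃ I : Finset (Fin n), I.card = d ∧ Supporting x I ∧ F = PointedCone.hull ℝ (x '' I) := by
  classical
  have hxC : ∀ i, x i ∈ PointedCone.hull ℝ (Set.range x) :=
    fun i => PointedCone.subset_hull ⟨i, rfl⟩
  let J : Finset (Fin n) := Finset.univ.filter fun i => x i ∈ F
  have hJ : ∀ i, i ∈ J ↔ x i ∈ F := fun i => by simp [J]
  have hFJ : F = PointedCone.hull ℝ (x '' J) := by
    refine le_antisymm (fun y hy => ?_) (Submodule.span_le.2 ?_)
    · obtain ⟨c, hc, rfl⟩ := mem_hull_range (hF.le hy)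
      refine Submodule.sum_mem _ fun i _ => ?_
      rcases (hc i).eq_or_lt with h | h
      · rw [← h, zero_smul]
        exact Submodule.zero_mem _
      · exact PointedCone.smul_mem _ (hc i) (PointedCone.subset_hull
          ⟨i, (hJ i).2 (hF.mem_of_sum_smul_mem hxC hc hy i h), rfl⟩)
    · rintro _ ⟨i, hi, rfl⟩
      exact (hJ i).1 hi
  have hspan : Submodule.span ℝ (F : Set (Space d)) = Submodule.span ℝ (x '' J) := by
    rw [hFJ, span_hull]
  rw [hspan] at hd
  have hcard : J.card = d := by
    by_cases h : J.card ≤ d + 1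
    · rw [← hd, finrank_span_image hx h]
    -- More than `d + 1` generators would include `d + 1` independent ones, too many for a span of
    -- dimension `d`.
    · obtain ⟨K, hKJ, hK⟩ := Finset.exists_subset_card_eq (le_of_not_ge h)
      have h1 := finrank_span_image hx hK.le
      have h2 : Submodule.span ℝ (x '' K) ≤ Submodule.span ℝ (x '' J) :=
        Submodule.span_mono (Set.image_mono (by exact_mod_cast hKJ))
      have h3 := Submodule.finrank_mono h2
      omega
  refine ⟨J, hcard, ?_, hFJ⟩
  obtain ⟨φ, hφ⟩ := exists_functional hx hcard
  have h0 : ∀ i ∈ J, φ (x i) = 0 := fun i hi => (hφ _).2 (Submodule.subset_span ⟨i, hi, rfl⟩)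
  have hne : ∀ j ∉ J, φ (x j) ≠ 0 :=
    fun j hj h => notMem_span_of_generalPosition hx hcard hj ((hφ _).1 h)
  by_cases h1 : ∀ j ∉ J, 0 < φ (x j)
  · exact ⟨φ, h0, h1⟩
  by_cases h2 : ∀ j ∉ J, φ (x j) < 0
  · exact ⟨-φ, fun i hi => by simp [h0 i hi], fun j hj => by simpa using h2 j hj⟩
  exfalso
  push Not at h1 h2
  obtain ⟨a, ha, ha'⟩ := h1
  obtain ⟨b, hb, hb'⟩ := h2
  have ha0 : φ (x a) < 0 := lt_of_le_of_ne ha' (hne a ha)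
  have hb0 : 0 < φ (x b) := lt_of_le_of_ne hb' (hne b hb).symm
  have hp : φ (φ (x b) • x a + (-φ (x a)) • x b) = 0 := by
    simp only [map_add, map_smul, smul_eq_mul]
    ring
  obtain ⟨c, hc⟩ := (Submodule.mem_span_image_finset_iff_exists_fun ℝ).1 ((hφ _).1 hp)
  -- The combination is only in the linear span of the face; adding `|c i| • x i` makes all its
  -- coefficients nonnegative.
  have hmem : φ (x b) • x a + ((-φ (x a)) • x b + ∑ i : J, |c i| • x i) ∈ F := by
    rw [← add_assoc, ← hc, ← Finset.sum_add_distrib]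
    refine Submodule.sum_mem _ fun i _ => ?_
    rw [← add_smul]
    exact PointedCone.smul_mem _ (by linarith [neg_abs_le (c i)]) ((hJ _).1 i.2)
  refine ha ((hJ a).2 (hF.mem_of_smul_add_mem (hxC a) ?_ hb0 hmem))
  refine Submodule.add_mem _ (PointedCone.smul_mem _ (by linarith) (hxC b))
    (Submodule.sum_mem _ fun i _ => PointedCone.smul_mem _ (abs_nonneg _) (hxC _))

/-- A supporting functional vanishes on the hyperplane, hence is a multiple of `⟨w, ·⟩`; the sign of
the factor selects the side. The right-hand condition is visibly measurable. -/
theorem supporting_iff_oneSided {m : ℕ} (hm : 1 ≤ m) {x : Fin n → UnitSphere d}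
    (hx : GeneralPosition fun i => (x i : Space d)) {I : Finset (Fin n)}
    (σ : Fin d ⊕ Fin m ≃ Fin n) (hσ : ∀ i, σ i ∈ I ↔ i.isLeft) :
    Supporting (fun i => (x i : Space d)) I ↔
      OneSided (fun i => x (σ (.inl i))) fun j => x (σ (.inr j)) := by
  have hrange : Set.range (σ ∘ Sum.inl) = (I : Set (Fin n)) := by
    ext i
    constructor
    · rintro ⟨j, rfl⟩
      exact (hσ _).2 rfl
    · intro hi
      obtain ⟨j | j, rfl⟩ := σ.surjective i
      · exact ⟨j, rfl⟩
      · exact absurd ((hσ _).1 hi) (by simp)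
  have hinj : Function.Injective (σ ∘ Sum.inl) := σ.injective.comp Sum.inl_injective
  have hcard : I.card = d := by
    rw [← Set.ncard_coe_finset, ← hrange, Set.ncard_range_of_injective hinj, Nat.card_fin]
  have hLI : LinearIndependent ℝ fun i : Fin d => (x (σ (.inl i)) : Space d) := by
    have h := hx I (by omega)
    rw [← hrange, linearIndepOn_range_iff hinj] at h
    exact h
  have hzero := inner_normalVec_eq_zero_iff hLI
  set w := normalVec fun i : Fin d => (x (σ (.inl i)) : Space d) with hw
  have hspan : Set.range (fun i : Fin d => (x (σ (.inl i)) : Space d)) =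
      (fun i => (x i : Space d)) '' I := by
    rw [← hrange, ← Set.range_comp]
    rfl
  rw [hspan] at hzero
  have hJ : ∀ j : Fin m, σ (.inr j) ∉ I := fun j h => absurd ((hσ _).1 h) (by simp)
  have hw0 : ∀ i ∈ I, inner ℝ w (x i : Space d) = 0 :=
    fun i hi => (hzero _).2 (Submodule.subset_span ⟨i, hi, rfl⟩)
  have hcompl : ∀ j ∉ I, ∃ k : Fin m, σ (.inr k) = j := by
    intro j hj
    obtain ⟨i | i, rfl⟩ := σ.surjective j
    · exact absurd ((hσ _).2 rfl) hj
    · exact ⟨i, rfl⟩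
  constructor
  · rintro ⟨φ, h0, hpos⟩
    set z : Space d := (x (σ (.inr ⟨0, hm⟩)) : Space d) with hz
    have hz0 : inner ℝ w z ≠ 0 := fun h =>
      notMem_span_of_generalPosition hx hcard (hJ ⟨0, hm⟩) ((hzero _).1 h)
    -- Proportionality, read off from `⟨w, z⟩ y - ⟨w, y⟩ z`, which lies in the hyperplane and so is
    -- killed by `φ`.
    have hker : ∀ y, inner ℝ w y * φ z = φ y * inner ℝ w z := by
      intro y
      have h1 : inner ℝ w ((inner ℝ w z) • y - (inner ℝ w y) • z) = 0 := by
        rw [inner_sub_right, inner_smul_right, inner_smul_right]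
        ring
      have h2 : Submodule.span ℝ ((fun i => (x i : Space d)) '' I) ≤ φ.ker := by
        refine Submodule.span_le.2 ?_
        rintro _ ⟨i, hi, rfl⟩
        exact h0 i hi
      have h3 : φ ((inner ℝ w z) • y - (inner ℝ w y) • z) = 0 := h2 ((hzero _).1 h1)
      rw [map_sub, map_smul, map_smul, smul_eq_mul, smul_eq_mul] at h3
      linarith
    have hφz : 0 < φ z := hpos _ (hJ _)
    rcases lt_or_gt_of_ne hz0 with h | h
    · right
      intro j
      have h1 := hker (x (σ (.inr j)))
      have h2 := hpos _ (hJ j)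
      by_contra! h3
      nlinarith [mul_nonneg h3 hφz.le, mul_neg_of_pos_of_neg h2 h]
    · left
      intro j
      have h1 := hker (x (σ (.inr j)))
      have h2 := hpos _ (hJ j)
      by_contra! h3
      nlinarith [mul_nonneg (neg_nonneg.2 h3) hφz.le, mul_pos h2 h]
  · rintro (h | h)
    · refine ⟨innerₛₗ ℝ w, hw0, fun j hj => ?_⟩
      obtain ⟨k, rfl⟩ := hcompl j hj
      exact h k
    · refine ⟨-innerₛₗ ℝ w, fun i hi => neg_eq_zero.2 (hw0 i hi), fun j hj => ?_⟩
      obtain ⟨k, rfl⟩ := hcompl j hj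
      exact neg_pos.2 (h k)

theorem pos_convS (A : Set (UnitSphere d)) : pos (convS A) = pos A := by
  refine le_antisymm (Submodule.span_le.2 ?_) (Submodule.span_mono (Set.image_mono ?_))
  · rintro _ ⟨u, hu, rfl⟩
    exact hu
  · intro u hu
    exact PointedCone.subset_hull ⟨u, hu, rfl⟩

open Classical in
theorem faceNumber_convS_range (hd : 1 ≤ d) {x : Fin n → UnitSphere d}
    (hx : GeneralPosition fun i => (x i : Space d)) :
    faceNumber (d - 1) (convS (Set.range x)) =
      ((Finset.univ.powersetCard d).filter fun I : Finset (Fin n) =>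
        Supporting (fun i => (x i : Space d)) I).card := by
  have hpos : pos (convS (Set.range x)) =
      PointedCone.hull ℝ (Set.range fun i => (x i : Space d)) := by
    rw [pos_convS, pos, ← Set.range_comp]
    rfl
  let G : Finset (Fin n) → Set (UnitSphere d) := fun I =>
    {u | (u : Space d) ∈ PointedCone.hull ℝ ((fun i => (x i : Space d)) '' I)}
  set T := (Finset.univ.powersetCard d).filter fun I : Finset (Fin n) =>
    Supporting (fun i => (x i : Space d)) I with hT
  have hmemT : ∀ I, I ∈ T ↔ I.card = d ∧ Supporting (fun i => (x i : Space d)) I := by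
    intro I
    simp [hT, Finset.mem_powersetCard]
  have hfaces : faces (d - 1) (convS (Set.range x)) = G '' T := by
    ext S
    simp only [faces, hpos, Nat.sub_add_cancel hd]
    constructor
    · rintro ⟨F, hF, hdim, rfl⟩
      obtain ⟨I, hI, hsup, rfl⟩ := exists_supporting_of_isFaceOf hx hF hdim
      exact ⟨I, (hmemT I).2 ⟨hI, hsup⟩, rfl⟩
    · rintro ⟨I, hI, rfl⟩
      obtain ⟨hI, hsup⟩ := (hmemT I).1 hI
      exact ⟨_, isFaceOf_of_supporting hsup,
        by rw [span_hull, finrank_span_image hx (by omega), hI], rfl⟩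
  have hinj : Set.InjOn G T := by
    intro I hI J hJ h
    ext i
    rw [← mem_hull_image_iff_of_supporting ((hmemT I).1 hI).2,
      ← mem_hull_image_iff_of_supporting ((hmemT J).1 hJ).2]
    have : x i ∈ G I ↔ x i ∈ G J := by rw [h]
    exact this
  rw [faceNumber, hfaces, hinj.ncard_image, Set.ncard_coe_finset]

end Cone

/-! ### The expected facet number. -/

theorem measurePreserving_sum_split {S : Type*} [MeasurableSpace S] (ρ : Measure S)
    [SigmaFinite ρ] {n a b : ℕ} (σ : Fin a ⊕ Fin b ≃ Fin n) :
    MeasurePreserving (fun x : Fin n → S =>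
      ((fun i => x (σ (.inl i)) : Fin a → S), (fun j => x (σ (.inr j)) : Fin b → S)))
      (Measure.pi fun _ => ρ) ((Measure.pi fun _ => ρ).prod (Measure.pi fun _ => ρ)) := by
  have h1 := (measurePreserving_piCongrLeft (fun _ : Fin n => ρ) σ).symm
  have h2 := measurePreserving_sumPiEquivProdPi (fun _ : Fin a ⊕ Fin b => ρ)
  exact h2.comp h1

theorem ae_generalPosition {d n : ℕ} (hn : d + 1 ≤ n) {ρ : Measure (UnitSphere d)}
    [IsProbabilityMeasure ρ]
    (hρ : ∀ V : Submodule ℝ (Space d), V ≠ ⊤ → ρ {u | (u : Space d) ∈ V} = 0) :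
    ∀ᵐ x ∂Measure.pi fun _ : Fin n => ρ, GeneralPosition fun i => (x i : Space d) := by
  have h : ∀ s : Finset (Fin n), s.card = d + 1 → ∀ᵐ x ∂Measure.pi fun _ : Fin n => ρ,
      LinearIndepOn ℝ (fun i => (x i : Space d)) (s : Set (Fin n)) := by
    intro s hs
    have hsc : sᶜ.card = n - (d + 1) := by rw [Finset.card_compl, Fintype.card_fin, hs]
    have hmp := measurePreserving_fst.comp
      (measurePreserving_sum_split ρ (finSumEquivOfFinset hs hsc))
    have hLI := hmp.quasiMeasurePreserving.ae (ae_linearIndependent hρ le_rfl)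
    filter_upwards [hLI] with x hx
    have hrange : Set.range (s.orderEmbOfFin hs) = (s : Set (Fin n)) :=
      Finset.range_orderEmbOfFin s hs
    rw [← hrange, linearIndepOn_range_iff (s.orderEmbOfFin hs).injective]
    simp only [Function.comp, finSumEquivOfFinset_inl] at hx
    exact hx
  filter_upwards [ae_all_iff.2 fun s : {s : Finset (Fin n) // s.card = d + 1} => h s.1 s.2]
    with x hx s hs
  -- Only sets of size exactly `d + 1` need checking: since `n ≥ d + 1`, smaller ones extend to such
  -- a set and inherit independence.
  obtain ⟨t, hst, ht⟩ := Finset.exists_superset_card_eq hs (by simpa using hn)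
  exact (hx ⟨t, ht⟩).mono (by exact_mod_cast hst)

open Classical in
theorem integral_faceNumber {d n : ℕ} (hd : 1 ≤ d) (hn : d + 1 ≤ n) (e : UnitSphere d)
    {Ω : Type*} [MeasurableSpace Ω] {Q : Measure Ω} [IsProbabilityMeasure Q]
    {X : Fin n → Ω → UnitSphere d} (hX : IsUniformSample e Q X) :
    Integrable (fun ω => (faceNumber (d - 1) (randomPolytope X ω) : ℝ)) Q ∧
      ∫ ω, (faceNumber (d - 1) (randomPolytope X ω) : ℝ) ∂Q =
        2 * omega d / omega (d + 1) * (n.choose d : ℝ) *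
          ∫ α in (0 : ℝ)..Real.pi, (1 - α / Real.pi) ^ (n - d) * Real.sin α ^ (d - 1) := by
  have hω := omega_pos (k := d + 1) (by omega)
  have hω' := omega_pos (k := d) (by omega)
  have hXm : AEMeasurable (fun ω i => X i ω) Q :=
    aemeasurable_pi_lambda _ fun i => (hX.law i).aemeasurable
  have hmap : Q.map (fun ω i => X i ω) = Measure.pi fun _ => uniformHalfsphere e := by
    have h := (iIndepFun_iff_map_fun_eq_pi_map fun i => (hX.law i).aemeasurable).1 hX.indep
    simpa only [fun i => (hX.law i).map_eq] using h
  have hgp : ∀ᵐ ω ∂Q, GeneralPosition fun i => (X i ω : Space d) := by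
    have h := ae_generalPosition hn (uniformHalfsphere_submodule e)
    rw [← hmap] at h
    exact ae_of_ae_map hXm h
  have hface : ∀ᵐ ω ∂Q, (faceNumber (d - 1) (randomPolytope X ω) : ℝ) =
      ∑ I ∈ Finset.univ.powersetCard d,
        {ω | Supporting (fun i => (X i ω : Space d)) I}.indicator 1 ω := by
    filter_upwards [hgp] with ω hω
    rw [randomPolytope, faceNumber_convS_range hd hω, Finset.card_filter, Nat.cast_sum]
    refine Finset.sum_congr rfl fun I _ => ?_
    simp [Set.indicator]
  set p : ℝ := 2 * omega d / omega (d + 1) *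
    ∫ α in (0 : ℝ)..Real.pi, (1 - α / Real.pi) ^ (n - d) * Real.sin α ^ (d - 1) with hp
  have hp0 : 0 ≤ p := by
    refine mul_nonneg (by positivity) (intervalIntegral.integral_nonneg Real.pi_pos.le ?_)
    intro α hα
    have h1 : 0 ≤ 1 - α / Real.pi := by
      rw [sub_nonneg, div_le_one Real.pi_pos]; exact hα.2
    have h2 := Real.sin_nonneg_of_nonneg_of_le_pi hα.1 hα.2
    positivity
  have hI : ∀ I ∈ (Finset.univ : Finset (Fin n)).powersetCard d,
      NullMeasurableSet {ω | Supporting (fun i => (X i ω : Space d)) I} Q ∧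
      Q.real {ω | Supporting (fun i => (X i ω : Space d)) I} = p := by
    intro I hI
    have hIc : I.card = d := (Finset.mem_powersetCard.1 hI).2
    have hIcc : Iᶜ.card = n - d := by rw [Finset.card_compl, Fintype.card_fin, hIc]
    let σ := finSumEquivOfFinset hIc hIcc
    have hσ : ∀ i, σ i ∈ I ↔ i.isLeft := by
      rintro (i | i)
      · simp [σ, Finset.orderEmbOfFin_mem]
      · have := Finset.mem_compl.1 (Finset.orderEmbOfFin_mem Iᶜ hIcc i)
        simpa [σ] using this
    have hmp := measurePreserving_sum_split (uniformHalfsphere e) σ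
    let B : Set (Fin n → UnitSphere d) :=
      {x | OneSided (fun i => x (σ (.inl i))) fun j => x (σ (.inr j))}
    have hB : MeasurableSet B := hmp.measurable (measurableSet_oneSided d (n - d))
    -- The supporting event is handled through its almost sure equality with the preimage of a
    -- measurable set, so null measurability is all that is claimed for it.
    have hae : {ω | Supporting (fun i => (X i ω : Space d)) I} =ᵐ[Q]
        (fun ω i => X i ω) ⁻¹' B := by
      filter_upwards [hgp] with ω hω
      exact propext (supporting_iff_oneSided (m := n - d) (by omega) hω σ hσ)
    have hBn : NullMeasurableSet ((fun ω i => X i ω) ⁻¹' B) Q :=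
      hXm.nullMeasurableSet_preimage hB
    refine ⟨hBn.congr hae.symm, ?_⟩
    have h1 : Q ((fun ω i => X i ω) ⁻¹' B) = ENNReal.ofReal p := by
      rw [← Measure.map_apply_of_aemeasurable hXm hB, hmap,
        ← prod_oneSided hd (by omega : 1 ≤ n - d) e]
      exact hmp.measure_preimage (measurableSet_oneSided d (n - d)).nullMeasurableSet
    rw [measureReal_def, measure_congr hae, h1, ENNReal.toReal_ofReal hp0]
  have hint : ∀ I ∈ (Finset.univ : Finset (Fin n)).powersetCard d, Integrable
      ({ω | Supporting (fun i => (X i ω : Space d)) I}.indicator (1 : Ω → ℝ)) Q :=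
    fun I h => (integrable_const (1 : ℝ)).indicator₀ (hI I h).1
  refine ⟨(integrable_finsetSum _ hint).congr ?_, ?_⟩
  · filter_upwards [hface] with ω hω
    rw [hω]
  · rw [integral_congr_ae hface, integral_finsetSum _ hint]
    have h2 : ∀ I ∈ (Finset.univ : Finset (Fin n)).powersetCard d,
        ∫ ω, {ω | Supporting (fun i => (X i ω : Space d)) I}.indicator (1 : Ω → ℝ) ω ∂Q = p := by
      intro I h
      rw [integral_indicator₀ (hI I h).1]
      simpa using (hI I h).2
    rw [Finset.sum_congr rfl h2, Finset.sum_const, Finset.card_powersetCard, Finset.card_univ,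
      Fintype.card_fin, nsmul_eq_mul, hp]
    ring

/-! ### Asymptotics and the limiting constant. -/

theorem integral_pow_mul_exp_neg_div_pi (k : ℕ) :
    ∫ s in Set.Ioi (0 : ℝ), s ^ k * Real.exp (-(s / Real.pi)) =
      Real.pi ^ (k + 1) * (k.factorial : ℝ) := by
  have h := Real.integral_rpow_mul_exp_neg_mul_Ioi (a := (k : ℝ) + 1) (r := 1 / Real.pi)
    (by positivity) (by positivity)
  rw [Real.Gamma_nat_eq_factorial, one_div_one_div] at h
  simp only [add_sub_cancel_right, Real.rpow_natCast] at h
  rw [show (k : ℝ) + 1 = ((k + 1 : ℕ) : ℝ) by push_cast; ring, Real.rpow_natCast] at h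
  rw [← h]
  refine setIntegral_congr_fun measurableSet_Ioi fun s _ => ?_
  simp only [div_eq_inv_mul, mul_one]

/-- After `s = m α` the integrand is `(1 - s/(π m))^m (m sin (s/m))^k` on `(0, mπ]`. It tends to
`s^k exp (-s/π)` and is dominated by it, by `1 - x ≤ exp (-x)` and `sin x ≤ x`. -/
theorem tendsto_pow_mul_integral_sin (k : ℕ) :
    Filter.Tendsto (fun m : ℕ => (m : ℝ) ^ (k + 1) *
      ∫ α in (0 : ℝ)..Real.pi, (1 - α / Real.pi) ^ m * Real.sin α ^ k) Filter.atTop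
      (nhds (Real.pi ^ (k + 1) * (k.factorial : ℝ))) := by
  have hpi := Real.pi_pos
  let F : ℕ → ℝ → ℝ := fun m => (Set.Ioc (0 : ℝ) (m * Real.pi)).indicator fun s =>
    (1 - s / Real.pi / m) ^ m * (m * Real.sin (s / m)) ^ k
  have hF : ∀ m : ℕ, 1 ≤ m → ∫ s in Set.Ioi (0 : ℝ), F m s = (m : ℝ) ^ (k + 1) *
      ∫ α in (0 : ℝ)..Real.pi, (1 - α / Real.pi) ^ m * Real.sin α ^ k := by
    intro m hm
    have hm' : (m : ℝ) ≠ 0 := by positivity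
    have h1 := intervalIntegral.integral_comp_div (a := 0) (b := m * Real.pi)
      (fun α => (1 - α / Real.pi) ^ m * Real.sin α ^ k) hm'
    rw [zero_div, mul_div_cancel_left₀ _ hm', smul_eq_mul] at h1
    rw [pow_succ, mul_assoc, ← h1, ← intervalIntegral.integral_const_mul,
      intervalIntegral.integral_of_le (by positivity)]
    simp only [F]
    rw [setIntegral_indicator measurableSet_Ioc,
      Set.inter_eq_right.2 (Set.Ioc_subset_Ioi_self : Set.Ioc (0 : ℝ) _ ⊆ _)]
    refine setIntegral_congr_fun measurableSet_Ioc fun s _ => ?_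
    simp only [mul_pow, div_right_comm s Real.pi]
    ring
  have hlim : Filter.Tendsto (fun m => ∫ s in Set.Ioi (0 : ℝ), F m s) Filter.atTop
      (nhds (∫ s in Set.Ioi (0 : ℝ), s ^ k * Real.exp (-(s / Real.pi)))) := by
    refine tendsto_integral_of_dominated_convergence
      (fun s => s ^ k * Real.exp (-(s / Real.pi))) (fun m => ?_) ?_ (fun m => ?_) ?_
    · refine Measurable.aestronglyMeasurable (Measurable.indicator ?_ measurableSet_Ioc)
      fun_prop
    -- The integral of a nonintegrable function is 0 by convention, so the nonzero Gamma value
    -- already gives integrability.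
    · refine Integrable.of_integral_ne_zero ?_
      rw [integral_pow_mul_exp_neg_div_pi]
      positivity
    · filter_upwards [ae_restrict_mem measurableSet_Ioi] with s hs
      have hs0 : 0 < s := hs
      by_cases hsm : s ∈ Set.Ioc (0 : ℝ) (m * Real.pi)
      · have hm : 0 < (m : ℝ) := by
          by_contra! h
          have := hsm.2
          nlinarith
        have h1 : s / Real.pi ≤ m := by rw [div_le_iff₀ hpi]; exact hsm.2
        have h2 : 0 ≤ 1 - s / Real.pi / m := by
          rw [sub_nonneg, div_le_one hm]; exact h1
        have h3 : 0 ≤ Real.sin (s / m) := by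
          refine Real.sin_nonneg_of_nonneg_of_le_pi (by positivity) ?_
          rw [div_le_iff₀ hm, mul_comm]; exact hsm.2
        have h4 : (m : ℝ) * Real.sin (s / m) ≤ s := by
          have := Real.sin_le (x := s / m) (by positivity)
          calc (m : ℝ) * Real.sin (s / m) ≤ m * (s / m) := by gcongr
            _ = s := by field_simp
        simp only [F]
        rw [Set.indicator_of_mem hsm, Real.norm_of_nonneg (by positivity), mul_comm]
        gcongr
        exact Real.one_sub_div_pow_le_exp_neg h1
      · simp only [F]
        rw [Set.indicator_of_notMem hsm, norm_zero]
        positivity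
    · filter_upwards [ae_restrict_mem measurableSet_Ioi] with s hs
      have hs0 : 0 < s := hs
      have h1 := Real.tendsto_one_add_div_pow_exp (-(s / Real.pi))
      have h2 : Filter.Tendsto (fun m : ℕ => s * Real.sinc (s / m)) Filter.atTop (nhds s) := by
        have h3 := (Real.continuous_sinc.tendsto 0).comp
          (tendsto_const_div_atTop_nhds_zero_nat s)
        simpa using h3.const_mul s
      have h4 := (h2.pow k).mul h1
      refine h4.congr' ?_
      have h5 : ∀ᶠ m : ℕ in Filter.atTop, s / Real.pi ≤ (m : ℝ) :=
        tendsto_natCast_atTop_atTop.eventually_ge_atTop _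
      filter_upwards [h5, Filter.eventually_ge_atTop 1] with m hm hm1
      have hm' : (0 : ℝ) < m := by positivity
      simp only [F]
      have hmem : s ∈ Set.Ioc (0 : ℝ) (m * Real.pi) := ⟨hs0, (div_le_iff₀ hpi).1 hm⟩
      rw [Set.indicator_of_mem hmem,
        Real.sinc_of_ne_zero (by positivity), mul_comm]
      congr 1
      · congr 1
        ring
      · congr 1
        field_simp
  rw [integral_pow_mul_exp_neg_div_pi] at hlim
  refine hlim.congr' ?_
  filter_upwards [Filter.eventually_ge_atTop 1] with m hm
  exact hF m hm

theorem tendsto_choose_mul_integral_sin {d : ℕ} (hd : 1 ≤ d) :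
    Filter.Tendsto (fun n : ℕ => (n.choose d : ℝ) *
      ∫ α in (0 : ℝ)..Real.pi, (1 - α / Real.pi) ^ (n - d) * Real.sin α ^ (d - 1)) Filter.atTop
      (nhds (Real.pi ^ d / d)) := by
  -- Writing `n = m + d` makes the truncated subtraction `n - d` exact.
  rw [← Filter.tendsto_add_atTop_iff_nat d]
  simp only [Nat.add_sub_cancel]
  have h1 := tendsto_pow_mul_integral_sin (d - 1)
  rw [Nat.sub_add_cancel hd] at h1
  have h2 : Filter.Tendsto (fun m : ℕ => ((m + d).choose d : ℝ) /
      (((m + d : ℕ) : ℝ) ^ d / d.factorial)) Filter.atTop (nhds 1) := by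
    have hne : ∀ᶠ n : ℕ in Filter.atTop, (n : ℝ) ^ d / d.factorial ≠ 0 := by
      filter_upwards [Filter.eventually_ge_atTop 1] with n hn
      positivity
    exact ((Asymptotics.isEquivalent_iff_tendsto_one hne).1 (isEquivalent_choose d)).comp
      (Filter.tendsto_add_atTop_nat d)
  have h3 := ((tendsto_natCast_div_add_atTop (d : ℝ)).pow d).inv₀ (by simp)
  have h4 := ((h2.mul h3).mul_const (1 / (d.factorial : ℝ))).mul h1
  have hval : 1 * (1 ^ d)⁻¹ * (1 / (d.factorial : ℝ)) *
      (Real.pi ^ d * ((d - 1).factorial : ℝ)) = Real.pi ^ d / d := by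
    obtain ⟨k, rfl⟩ : ∃ k, d = k + 1 := ⟨d - 1, by omega⟩
    rw [Nat.factorial_succ, Nat.add_sub_cancel]
    have := Nat.factorial_ne_zero k
    push_cast
    field_simp
    simp
  rw [hval] at h4
  refine h4.congr' ?_
  filter_upwards [Filter.eventually_ge_atTop 1] with m hm
  have hm' : (0 : ℝ) < m := by positivity
  have hfac : (d.factorial : ℝ) ≠ 0 := by positivity
  rw [← mul_assoc]
  congr 1
  push_cast
  rw [div_pow]
  field_simp

/-- Legendre's duplication formula at `d / 2` expresses `Γ(d)`, hence `d!`, through `Γ(d/2)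
Γ((d+1)/2)`, the Gamma values in `ω_d` and `ω_{d+1}`. -/
theorem omega_ratio {d : ℕ} (hd : 1 ≤ d) :
    2 * omega d / omega (d + 1) * (Real.pi ^ d / d) =
      ((2 : ℝ) ^ d)⁻¹ * (d.factorial : ℝ) * kappa d ^ 2 := by
  have hpi := Real.pi_pos
  have hd0 : (0 : ℝ) < d := by exact_mod_cast hd
  have hΓ : 0 < Real.Gamma ((d : ℝ) / 2) := Real.Gamma_pos_of_pos (by positivity)
  have hΓ' : 0 < Real.Gamma ((d : ℝ) / 2 + 1 / 2) := Real.Gamma_pos_of_pos (by positivity)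
  have hdup := Real.Gamma_mul_Gamma_add_half ((d : ℝ) / 2)
  rw [show 2 * ((d : ℝ) / 2) = d by ring] at hdup
  have hfac : (d.factorial : ℝ) = d * Real.Gamma d := by
    rw [← Real.Gamma_add_one hd0.ne', Real.Gamma_nat_eq_factorial]
  have hpow : (2 : ℝ) ^ (1 - (d : ℝ)) = 2 * ((2 : ℝ) ^ d)⁻¹ := by
    rw [Real.rpow_sub two_pos, Real.rpow_one, Real.rpow_natCast, div_eq_mul_inv]
  rw [hpow] at hdup
  have hP : Real.pi ^ ((d : ℝ) / 2) * Real.pi ^ ((d : ℝ) / 2) = Real.pi ^ d := by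
    rw [← Real.rpow_add hpi, add_halves, Real.rpow_natCast]
  have hP' : Real.pi ^ (((d + 1 : ℕ) : ℝ) / 2) = Real.pi ^ ((d : ℝ) / 2) * √Real.pi := by
    rw [Real.sqrt_eq_rpow, ← Real.rpow_add hpi]
    congr 1
    push_cast
    ring
  have hs : √Real.pi ≠ 0 := by positivity
  have hA : Real.pi ^ ((d : ℝ) / 2) ≠ 0 := by positivity
  rw [kappa, omega, omega, hP', show (((d + 1 : ℕ) : ℝ) / 2) = (d : ℝ) / 2 + 1 / 2 by
    push_cast; ring, hfac, ← hP]
  have hG : Real.Gamma d = Real.Gamma ((d : ℝ) / 2) * Real.Gamma ((d : ℝ) / 2 + 1 / 2) *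
      2 ^ d / (2 * √Real.pi) := by
    rw [hdup]
    field_simp
  rw [hG]
  field_simp

end HalfspherePolytope

end

theorem theoremT1 (d : ℕ) (hd : 2 ≤ d) (e : HalfspherePolytope.UnitSphere d) :
    (∀ (n : ℕ), d + 1 ≤ n →
      ∀ (Ω : Type*) [MeasurableSpace Ω] (Q : Measure Ω) [IsProbabilityMeasure Q]
        (X : Fin n → Ω → HalfspherePolytope.UnitSphere d),
        HalfspherePolytope.IsUniformSample e Q X →
        Integrable (fun ω => (HalfspherePolytope.faceNumber (d - 1)
          (HalfspherePolytope.randomPolytope X ω) : ℝ)) Q ∧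
        ∫ ω, (HalfspherePolytope.faceNumber (d - 1)
            (HalfspherePolytope.randomPolytope X ω) : ℝ) ∂Q =
          2 * HalfspherePolytope.omega d / HalfspherePolytope.omega (d + 1) * (n.choose d : ℝ) *
            ∫ α in (0 : ℝ)..Real.pi,
              (1 - α / Real.pi) ^ (n - d) * Real.sin α ^ (d - 1)) ∧
    (∀ (Ω : ℕ → Type*) [∀ n, MeasurableSpace (Ω n)] (Q : ∀ n, Measure (Ω n))
        [∀ n, IsProbabilityMeasure (Q n)]
        (X : ∀ n, Fin n → Ω n → HalfspherePolytope.UnitSphere d),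
        (∀ n, d + 1 ≤ n → HalfspherePolytope.IsUniformSample e (Q n) (X n)) →
        Filter.Tendsto
          (fun n => ∫ ω, (HalfspherePolytope.faceNumber (d - 1)
            (HalfspherePolytope.randomPolytope (X n) ω) : ℝ) ∂(Q n))
          Filter.atTop
          (nhds (((2 : ℝ) ^ d)⁻¹ * (d.factorial : ℝ) * HalfspherePolytope.kappa d ^ 2))) := by
  have hd1 : 1 ≤ d := by omega
  refine ⟨fun n hn Ω _ Q _ X hX => HalfspherePolytope.integral_faceNumber hd1 hn e hX,
    fun Ω _ Q _ X hX => ?_⟩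
  rw [← HalfspherePolytope.omega_ratio hd1]
  refine ((HalfspherePolytope.tendsto_choose_mul_integral_sin hd1).const_mul _).congr' ?_
  -- Nothing is assumed of the samples for `n ≤ d`, so the exact formula is used only eventually.
  filter_upwards [Filter.eventually_ge_atTop (d + 1)] with n hn
  rw [(HalfspherePolytope.integral_faceNumber hd1 hn e (hX n hn)).2, mul_assoc]
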